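/- For words $u$ and $v$ let $\binom{u}{v}$ be the number of occurrences of $v$ as a scattered factor of $u$, i.e. the number of index sequences $i_1<\dots<i_{|v|}$ with $u[i_1]\cdots u[i_{|v|}]=v$. Two words $w_1,w_2$ over a finite alphabet $\Sigma$ are $k$-binomial equivalent, $w_1\equiv_k w_2$, if $\binom{w_1}{v}=\binom{w_2}{v}$ for all words $v$ over $\Sigma$ of length at most $k$. The model of computation is the unit-cost RAM whose memory cells hold words of $W$ bits, with $W$ at least a constant times the logarithm of the input size ($W\ge c\log(n+|\Sigma|+2)$). Its instructions, each costing one unit of time, are arithmetic and bitwise operations, data movement with indirect addressing, conditional and unconditional jumps, and the generation of a uniformly random $W$-bit word. The input consists of $n$, $k$ and the letters of $w_1$ and $w_2$, encoded as integers in $\{0,\dots,|\Sigma|-1\}$, one per cell. **Theorem.** (a) There is a randomised algorithm (a fixed program of this machine) which, given $w_1,w_2\in\Sigma^*$ with $|w_1|=|w_2|=n$ and $k\le n$, always stops with an answer YES or NO after $O(nk^2+k^4)$ steps (for $k=0$: after $O(1)$ steps), whatever the random words are. If $w_1\equiv_k w_2$, it always answers YES; if $w_1\not\equiv_k w_2$,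 it answers NO with probability at least $1-\frac1n$. The program and the constants do not depend on $n$, $k$, $\Sigma$, $W$ or the words. (b) For binary words put $Q_{k,w}(x)=\sum_{1\le|v|\le k}\binom{w}{v}x^{\mathrm{bin}(1v)}\in\mathbb Z[x]$, where $v$ runs over the words over $\{0,1\}$ and $\mathrm{bin}(1v)$ is the number with binary representation $1v$. Let $w_1,w_2\in\{0,1\}^n$ and $k\le n$. Consider the test that draws $p$ uniformly from the primes with exactly $\lceil k+1+2\log_2 n\rceil$ binary digits, then draws $x$ uniformly from $\mathbb F_p$, and answers YES if $Q_{k,w_1}(x)=Q_{k,w_2}(x)$ in $\mathbb F_p$ and NO otherwise. If $w_1\equiv_k w_2$, this test always answers YES; if $w_1\not\equiv_k w_2$, it answers NO with probability at least $1-\frac1n$. -/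

import Mathlib

/-! ### Words, binomial coefficients of words, `k`-binomial equivalence

A word of length `n` over an alphabet with `σ` letters is a function `Fin n → Fin σ`. -/

namespace KBinomial

/-- The binomial coefficient of the words `u` and `v`: the number of occurrences of `v` as a
scattered factor of `u`, that is, of increasing sequences of positions of `u` that spell `v`. -/
def binom {σ n m : ℕ} (u : Fin n → Fin σ) (v : Fin m → Fin σ) : ℕ :=
  (Finset.univ.filter fun f : Fin m → Fin n =>
    (∀ i j, i < j → f i < f j) ∧ ∀ i, u (f i) = v i).card

/-- `w₁ ≡_k w₂`: every word of length at most `k` has the same number of scattered occurrences in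
`w₁` and in `w₂`. -/
def BinomEquiv {σ n : ℕ} (k : ℕ) (w₁ w₂ : Fin n → Fin σ) : Prop :=
  ∀ m ≤ k, ∀ v : Fin m → Fin σ, binom w₁ v = binom w₂ v

/-! ### The fingerprint test on binary words -/

/-- `bin(1v)`: the number whose binary representation is `1` followed by the word `v`. -/
def binOne {m : ℕ} (v : Fin m → Fin 2) : ℕ :=
  2 ^ m + ∑ i : Fin m, (v i : ℕ) * 2 ^ (m - 1 - (i : ℕ))

/-- `Q_{k,w} = ∑ (w choose v) x^{bin(1v)}` over the non-empty binary words `v` of length at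
most `k`, as a polynomial with integer coefficients. -/
noncomputable def Q {n : ℕ} (k : ℕ) (w : Fin n → Fin 2) : Polynomial ℤ :=
  ∑ m ∈ Finset.Icc 1 k, ∑ v : Fin m → Fin 2,
    Polynomial.C (binom w v : ℤ) * Polynomial.X ^ binOne v

/-- The primes with exactly `t` binary digits. -/
def bitPrimes (t : ℕ) : Finset ℕ :=
  (Finset.Ico (2 ^ (t - 1)) (2 ^ t)).filter Nat.Prime

/-- The number of bits `⌈k + 1 + 2 log₂ n⌉` of the random prime. -/
noncomputable def primeBits (n k : ℕ) : ℕ :=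
  ⌈(k : ℝ) + 1 + 2 * Real.logb 2 n⌉₊

/-- The probability that `Q_{k,w₁}(x) ≠ Q_{k,w₂}(x)` in `𝔽_p`, where `p` is uniformly distributed
on the primes with `⌈k + 1 + 2 log₂ n⌉` bits and, given `p`, `x` is uniformly distributed
on `𝔽_p`. -/
noncomputable def fingerprintNoProb {n : ℕ} (k : ℕ) (w₁ w₂ : Fin n → Fin 2) : ℝ :=
  (∑ p ∈ bitPrimes (primeBits n k),
      (Set.ncard {x : ZMod p | Polynomial.aeval x (Q k w₁) ≠ Polynomial.aeval x (Q k w₂)} : ℝ) / p)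
    / (bitPrimes (primeBits n k)).card

end KBinomial

/-! ### The randomised unit-cost RAM with words of `W` bits

There are registers and a memory with indirect addressing. Every register and memory cell holds a
word, represented by a natural number smaller than `2 ^ W`. Each instruction takes one unit
of time. -/

namespace WordRAM

/-- Arithmetic and bitwise operations. -/
inductive BinOp
  | add | sub | mul | div | rem | and | or | xor | shl | shr

/-- The value of an operation, as a `W`-bit word. Subtraction is cut off at zero. -/
def BinOp.eval (W : ℕ) (o : BinOp) (a b : ℕ) : ℕ :=
  (match o with
    | .add => a + b
    | .sub => a - b
    | .mul => a * b
    | .div => a / b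
    | .rem => a % b
    | .and => a &&& b
    | .or => a ||| b
    | .xor => a ^^^ b
    | .shl => a <<< b
    | .shr => a >>> b) % 2 ^ W

/-- Instructions; `d`, `a`, `b` are names of registers and `l` is a position in the program. -/
inductive Instr
  /-- `R[d] := c` for a constant `c` -/
  | const (d c : ℕ)
  /-- `R[d] := R[a]` -/
  | copy (d a : ℕ)
  /-- `R[d] := o (R[a], R[b])` -/
  | op (o : BinOp) (d a b : ℕ)
  /-- `R[d] :=` a fresh uniformly distributed random word -/
  | rand (d : ℕ)
  /-- `R[d] := M[R[a]]` -/
  | load (d a : ℕ)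
  /-- `M[R[a]] := R[b]` -/
  | store (a b : ℕ)
  /-- go to `l` -/
  | jump (l : ℕ)
  /-- if `R[a] = R[b]` go to `l` -/
  | jumpEq (a b l : ℕ)
  /-- if `R[a] < R[b]` go to `l` -/
  | jumpLt (a b l : ℕ)
  /-- stop and return an answer -/
  | halt (answer : Bool)

/-- A program is a finite list of instructions. -/
abbrev Program := List Instr

/-- A configuration of the machine. -/
structure Config where
  /-- the position of the next instruction -/
  pc : ℕ
  /-- the registers -/
  reg : ℕ → ℕ
  /-- the memory -/
  mem : ℕ → ℕ
  /-- how many random words have been read -/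
  used : ℕ
  /-- the answer, once the machine has stopped -/
  answer : Option Bool

/-- The effect of one instruction. The sequence `ω` holds the random words. -/
def Instr.exec {W : ℕ} (ω : ℕ → Fin (2 ^ W)) (s : Config) : Instr → Config
  | .const d c => { s with pc := s.pc + 1, reg := Function.update s.reg d (c % 2 ^ W) }
  | .copy d a => { s with pc := s.pc + 1, reg := Function.update s.reg d (s.reg a) }
  | .op o d a b =>
      { s with pc := s.pc + 1, reg := Function.update s.reg d (o.eval W (s.reg a) (s.reg b)) }
  | .rand d =>
      { s with
        pc := s.pc + 1, reg := Function.update s.reg d (ω s.used : ℕ), used := s.used + 1 }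
  | .load d a => { s with pc := s.pc + 1, reg := Function.update s.reg d (s.mem (s.reg a)) }
  | .store a b => { s with pc := s.pc + 1, mem := Function.update s.mem (s.reg a) (s.reg b) }
  | .jump l => { s with pc := l }
  | .jumpEq a b l => { s with pc := if s.reg a = s.reg b then l else s.pc + 1 }
  | .jumpLt a b l => { s with pc := if s.reg a < s.reg b then l else s.pc + 1 }
  | .halt r => { s with answer := some r }

/-- One step of the machine. A stopped machine stays as it is; a machine that has left its program
without a `halt` is stuck and never gives an answer. -/
def step (P : Program) {W : ℕ} (ω : ℕ → Fin (2 ^ W)) (s : Config) : Config :=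
  match s.answer with
  | some _ => s
  | none =>
    match P[s.pc]? with
    | none => s
    | some i => i.exec ω s

/-- The answer given by the machine within `T` steps from the configuration `s`, if any. -/
def answerWithin (P : Program) {W : ℕ} (ω : ℕ → Fin (2 ^ W)) (s : Config) (T : ℕ) : Option Bool :=
  ((step P ω)^[T] s).answer

/-- The sequence of random words that starts with `u`. A run of `T` steps reads no more than the
first `T` random words. -/
def extend {W T : ℕ} (u : Fin T → Fin (2 ^ W)) (i : ℕ) : Fin (2 ^ W) :=
  if h : i < T then u ⟨i, h⟩ else ⟨0, Nat.two_pow_pos W⟩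

/-- The probability that the machine gives the answer `r` within `T` steps from `s`, for independent
uniformly distributed random words of `W` bits. -/
noncomputable def probAnswer (P : Program) (W : ℕ) (s : Config) (T : ℕ) (r : Bool) : ℝ :=
  ((Finset.univ.filter fun u : Fin T → Fin (2 ^ W) =>
      answerWithin P (extend u) s T = some r).card : ℝ) /
    (Fintype.card (Fin T → Fin (2 ^ W)) : ℝ)

/-- The initial configuration for two words of length `n` and a number `k`: the registers `0` and
`1` hold `n` and `k`, the memory holds the letters of `w₁` and then those of `w₂`, one per
cell, and everything else is zero. -/
def start {σ n : ℕ} (k : ℕ) (w₁ w₂ : Fin n → Fin σ) : Config where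
  pc := 0
  reg := fun r => if r = 0 then n else if r = 1 then k else 0
  mem := fun i =>
    if h : i < n then (w₁ ⟨i, h⟩ : ℕ)
    else if h : i - n < n then (w₂ ⟨i - n, h⟩ : ℕ)
    else 0
  used := 0
  answer := none

end WordRAM

/-!
(a) Give the letter `a` an independent random weight `x a j` for each `j < k`, and let the
occurrence of a scattered factor at positions `i₀ < ⋯ < i_{m-1}` have weight `∏ j, x (w i_j) j`. The
total weight of the occurrences of length `m` is a polynomial in the weights whose coefficients are
the binomial coefficients of `w`. Hence words that are not `k`-binomial equivalent have different
polynomials for some `m ≤ k`, and by the Schwartz–Zippel lemma random weights below `X` fail to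
separate them with probability at most `m / X ≤ 1 / n`, as soon as `X ≥ n ^ 2`. Since `X` is a power
of two, random words reduced modulo `X` are uniform.

The total weights are at most `(n * X) ^ k`, so they are computed exactly, as integers with `k`
machine words. Appending a letter adds, for each length `j < k`, a one-word multiple of the `j`-th
integer to the next one, which takes `O(k ^ 2)` steps for each letter and `O(n * k ^ 2)` in total.

(b) The numbers `bin(1v)` are distinct, so the coefficients of `Q` are the binomial coefficients of
`w`. If they differ, the difference is at most a binomial coefficient of integers and has few prime
factors with the prescribed number of digits, whereas Chebyshev's estimate, from the factorization
of a central binomial coefficient, provides many such primes. Modulo any other of them, the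
difference of the two polynomials is a nonzero polynomial of degree less than `2 ^ (k + 1)`, with
few roots.
-/

namespace KBinomial

/-! ### Weighted counts of scattered factors -/

section WeightedCount

variable {α R S : Type*} [CommSemiring R] [CommSemiring S]

/-- The weighted number of scattered factors of length `j` of the first `i` letters of `w`: the
occurrence at positions `i₀ < i₁ < ⋯` has weight `x (w i₀) 0 * x (w i₁) 1 * ⋯`. -/
def weightedCount (x : α → ℕ → R) (w : ℕ → α) : ℕ → ℕ → R
  | _, 0 => 1
  | 0, _ + 1 => 0
  | i + 1, j + 1 => weightedCount x w i (j + 1) + x (w i) j * weightedCount x w i j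

@[simp]
theorem weightedCount_zero_right (x : α → ℕ → R) (w : ℕ → α) (i : ℕ) :
    weightedCount x w i 0 = 1 := by
  cases i <;> rfl

theorem weightedCount_congr {x y : α → ℕ → R} {w : ℕ → α} {i j : ℕ}
    (hxy : ∀ a < i, ∀ b < j, x (w a) b = y (w a) b) :
    weightedCount x w i j = weightedCount y w i j := by
  induction i generalizing j with
  | zero => cases j <;> rfl
  | succ i ih =>
    cases j with
    | zero => rfl
    | succ j =>
      rw [weightedCount, weightedCount, ih fun a ha => hxy a (by lia),
        ih fun a ha b hb => hxy a (by lia) b (by lia), hxy i (by lia) j (by lia)]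

theorem map_weightedCount (φ : R →+* S) (x : α → ℕ → R) (w : ℕ → α) (i j : ℕ) :
    φ (weightedCount x w i j) = weightedCount (fun a b => φ (x a b)) w i j := by
  induction i generalizing j with
  | zero => cases j <;> simp [weightedCount]
  | succ i ih => cases j <;> simp [weightedCount, ih]

theorem weightedCount_le {x : α → ℕ → ℕ} {w : ℕ → α} {X i j : ℕ}
    (hx : ∀ a < i, ∀ b < j, x (w a) b ≤ X) :
    weightedCount x w i j ≤ i.choose j * X ^ j := by
  induction i generalizing j with
  | zero => cases j <;> simp [weightedCount]
  | succ i ih =>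
    cases j with
    | zero => simp
    | succ j =>
      have hskip := ih (j := j + 1) fun a ha => hx a (by lia)
      have htake := ih (j := j) fun a ha b hb => hx a (by lia) b (by lia)
      calc weightedCount x w i (j + 1) + x (w i) j * weightedCount x w i j
          ≤ i.choose (j + 1) * X ^ (j + 1) + X * (i.choose j * X ^ j) :=
            Nat.add_le_add hskip (Nat.mul_le_mul (hx i (by lia) j (by lia)) htake)
        _ = (i + 1).choose (j + 1) * X ^ (j + 1) := by rw [Nat.choose_succ_succ]; ring

end WeightedCount

/-! ### Binomial coefficients of words -/

section Binom

variable {σ n m : ℕ}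

@[simp]
theorem binom_zero_right (w : Fin n → Fin σ) (v : Fin 0 → Fin σ) : binom w v = 1 := by
  simp [binom]

@[simp]
theorem binom_zero_left (w : Fin 0 → Fin σ) (v : Fin (m + 1) → Fin σ) : binom w v = 0 := by
  simp [binom]

open Finset in
theorem card_occurrences_last_ne (w : Fin (n + 1) → Fin σ) (v : Fin (m + 1) → Fin σ) :
    #{f : Fin (m + 1) → Fin (n + 1) |
      (∀ i j, i < j → f i < f j) ∧ (∀ i, w (f i) = v i) ∧ f (Fin.last m) ≠ Fin.last n} =
      binom (Fin.init w) v := by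
  symm
  rw [binom]
  refine card_bij (fun f _ a => (f a).castSucc) (fun f hf => ?_) (fun f _ g _ h => ?_)
    fun f hf => ?_
  · rw [mem_filter_univ] at hf ⊢
    simpa [Fin.init, Fin.castSucc_ne_last] using hf
  · exact funext fun a => Fin.castSucc_injective n (congrFun h a)
  · rw [mem_filter_univ] at hf
    have hmono : Monotone f := StrictMono.monotone hf.1
    have hlast (a) : f a ≠ Fin.last n := fun h =>
      hf.2.2 (Fin.last_le_iff.1 (h ▸ hmono a.le_last))
    exact ⟨fun a => (f a).castPred (hlast a), (mem_filter_univ _).2 ⟨hf.1, hf.2.1⟩, by simp⟩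

open Finset in
theorem card_occurrences_last_eq {w : Fin (n + 1) → Fin σ} {v : Fin (m + 1) → Fin σ}
    (h : w (Fin.last n) = v (Fin.last m)) :
    #{f : Fin (m + 1) → Fin (n + 1) |
      (∀ i j, i < j → f i < f j) ∧ (∀ i, w (f i) = v i) ∧ f (Fin.last m) = Fin.last n} =
      binom (Fin.init w) (Fin.init v) := by
  symm
  rw [binom]
  refine card_bij (fun f _ => Fin.snoc (α := fun _ => Fin (n + 1)) (fun a => (f a).castSucc)
    (Fin.last n)) (fun f hf => ?_) (fun f _ g _ h => ?_) fun f hf => ?_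
  · rw [mem_filter_univ] at hf ⊢
    simpa [Fin.init, Fin.forall_fin_succ', h, Fin.castSucc_lt_last, Fin.le_last] using hf
  · have h := (Fin.snoc_inj.1 h).1
    exact funext fun a => Fin.castSucc_injective n (congrFun h a)
  · rw [mem_filter_univ] at hf
    have hlast (a : Fin m) : f a.castSucc ≠ Fin.last n :=
      (hf.2.2 ▸ hf.1 _ _ a.castSucc_lt_last).ne
    refine ⟨fun a => (f a.castSucc).castPred (hlast a), (mem_filter_univ _).2
      ⟨fun i j hij => hf.1 _ _ (Fin.castSucc_lt_castSucc_iff.2 hij),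
        fun i => hf.2.1 i.castSucc⟩, ?_⟩
    rw [← hf.2.2]
    exact Fin.snoc_init_self f

theorem binom_succ_succ (w : Fin (n + 1) → Fin σ) (v : Fin (m + 1) → Fin σ) :
    binom w v = binom (Fin.init w) v +
      if w (Fin.last n) = v (Fin.last m) then binom (Fin.init w) (Fin.init v) else 0 := by
  rw [binom, ← Finset.card_filter_add_card_filter_not fun f => f (Fin.last m) ≠ Fin.last n]
  simp only [Finset.filter_filter, not_not, and_assoc]
  rw [card_occurrences_last_ne]
  split_ifs with h
  · rw [card_occurrences_last_eq h]
  · rw [add_right_inj, Finset.card_eq_zero, Finset.filter_eq_empty_iff]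
    rintro f - ⟨-, hf, hlast⟩
    exact h (hlast ▸ hf (Fin.last m))

theorem binom_le_choose (w : Fin n → Fin σ) (v : Fin m → Fin σ) : binom w v ≤ n.choose m := by
  induction n generalizing m with
  | zero => cases m <;> simp
  | succ n ih =>
    cases m with
    | zero => simp
    | succ m =>
      rw [binom_succ_succ, Nat.choose_succ_succ, add_comm]
      refine Nat.add_le_add ?_ (ih _ _)
      split_ifs
      exacts [ih _ _, Nat.zero_le _]

variable {R : Type*} [CommSemiring R] {u : Fin n → Fin σ} {w : ℕ → ℕ}

theorem weightedCount_eq_sum_binom (x : ℕ → ℕ → R) (hw : ∀ a : Fin n, w a = u a) (m : ℕ) :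
    weightedCount x w n m = ∑ v : Fin m → Fin σ, (binom u v : R) * ∏ a, x (v a) a := by
  induction n generalizing m with
  | zero => cases m <;> simp [weightedCount]
  | succ n ih =>
    have hinit (a : Fin n) : w a = Fin.init u a := hw a.castSucc
    cases m with
    | zero => simp
    | succ m =>
      rw [weightedCount, ih hinit, ih hinit, show w n = u (Fin.last n) from hw (Fin.last n)]
      simp only [binom_succ_succ, Nat.cast_add, add_mul, Finset.sum_add_distrib]
      congr 1
      rw [← (Fin.snocEquiv fun _ => Fin σ).sum_comp, Fintype.sum_prod_type_right, Finset.mul_sum]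
      refine Finset.sum_congr rfl fun v _ => ?_
      simp [Fin.snocEquiv, Fin.prod_univ_castSucc, ite_mul]
      ring

theorem weightedCount_indicator (hw : ∀ a : Fin n, w a = u a) (v : Fin m → Fin σ) :
    weightedCount (fun a j => if ∃ h : j < m, (v ⟨j, h⟩ : ℕ) = a then (1 : R) else 0) w n m =
      binom u v := by
  rw [weightedCount_eq_sum_binom _ hw, Finset.sum_eq_single v]
  · simp
  · intro v' _ hv
    obtain ⟨a, ha⟩ := Function.ne_iff.1 hv
    have hzero : ¬ ∃ h : (a : ℕ) < m, (v ⟨a, h⟩ : ℕ) = v' a := fun ⟨_, h⟩ => ha (Fin.ext h.symm)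
    rw [Finset.prod_eq_zero (Finset.mem_univ a) (if_neg hzero), mul_zero]
  · simp

theorem BinomEquiv.weightedCount_eq {u₁ u₂ : Fin n → Fin σ} {k : ℕ} (h : BinomEquiv k u₁ u₂)
    {w₁ w₂ : ℕ → ℕ} (hw₁ : ∀ a : Fin n, w₁ a = u₁ a) (hw₂ : ∀ a : Fin n, w₂ a = u₂ a)
    (x : ℕ → ℕ → R) (hm : m ≤ k) : weightedCount x w₁ n m = weightedCount x w₂ n m := by
  simp only [weightedCount_eq_sum_binom x hw₁, weightedCount_eq_sum_binom x hw₂, h m hm]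

end Binom

/-! ### The polynomial of weighted counts -/

section Polynomial

open MvPolynomial

variable {τ R : Type*} [CommSemiring R]

theorem totalDegree_weightedCount_le {α : Type*} {x : α → ℕ → MvPolynomial τ R}
    (hx : ∀ a j, (x a j).totalDegree ≤ 1) (w : ℕ → α) (i j : ℕ) :
    (weightedCount x w i j).totalDegree ≤ j := by
  induction i generalizing j with
  | zero => cases j <;> simp [weightedCount]
  | succ i ih =>
    cases j with
    | zero => simp
    | succ j =>
      have htake : (x (w i) j * weightedCount x w i j).totalDegree ≤ j + 1 :=
        (totalDegree_mul _ _).trans (by linarith [hx (w i) j, ih j])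
      exact (totalDegree_add _ _).trans (max_le (ih _) htake)

theorem weightedCount_X_ne [CharZero R] {σ n m : ℕ} {u₁ u₂ : Fin n → Fin σ} {w₁ w₂ : ℕ → ℕ}
    (hw₁ : ∀ a : Fin n, w₁ a = u₁ a) (hw₂ : ∀ a : Fin n, w₂ a = u₂ a) {L : Set ℕ}
    (hL₁ : ∀ a < n, w₁ a ∈ L) (hL₂ : ∀ a < n, w₂ a ∈ L) {idx : ℕ → ℕ → τ}
    (hidx : Set.InjOn (Function.uncurry idx) (L ×ˢ Set.Iio m)) {v : Fin m → Fin σ}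
    (hv : binom u₁ v ≠ binom u₂ v) :
    weightedCount (fun a j => (X (idx a j) : MvPolynomial τ R)) w₁ n m ≠
      weightedCount (fun a j => X (idx a j)) w₂ n m := by
  let ind (a j : ℕ) : R := if ∃ h : j < m, (v ⟨j, h⟩ : ℕ) = a then 1 else 0
  let inv := Function.invFunOn (Function.uncurry idx) (L ×ˢ Set.Iio m)
  have heval {u : Fin n → Fin σ} {w : ℕ → ℕ} (hw : ∀ a : Fin n, w a = u a)
      (hL : ∀ a < n, w a ∈ L) : eval (fun t => Function.uncurry ind (inv t))
        (weightedCount (fun a j => X (idx a j)) w n m) = binom u v := by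
    rw [map_weightedCount, ← weightedCount_indicator hw v]
    refine weightedCount_congr fun a ha b hb => ?_
    have hinv : inv (idx (w a) b) = (w a, b) :=
      hidx.leftInvOn_invFunOn (Set.mk_mem_prod (hL a ha) hb)
    rw [eval_X, hinv, Function.uncurry_apply_pair]
  intro h
  have heq := congrArg (eval fun t => Function.uncurry ind (inv t)) h
  rw [heval hw₁ hL₁, heval hw₂ hL₂, Nat.cast_inj] at heq
  exact hv heq

end Polynomial

/-! ### Primes with a given number of binary digits -/

section Primes

open Nat Finset

variable {N : ℕ}

theorem prod_Ioc_sqrt_pow_factorization_centralBinom_le (hN : 2 < N) :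
    ∏ p ∈ Ioc (sqrt (2 * N)) N, p ^ N.centralBinom.factorization p ≤ 4 ^ (2 * N / 3) := by
  refine le_trans ?_ (primorial_le_four_pow (2 * N / 3))
  have hone {p : ℕ} (hp : p ∈ Ioc (sqrt (2 * N)) N) (hp' : p ∉ primesLE (2 * N / 3)) :
      p ^ N.centralBinom.factorization p = 1 := by
    by_cases hprime : p.Prime
    · have h3 : 2 * N < 3 * p := by
        by_contra h
        exact hp' (mem_primesLE.2 ⟨by lia, hprime⟩)
      rw [factorization_centralBinom_of_two_mul_self_lt_three_mul hN (mem_Ioc.1 hp).2 h3, pow_zero]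
    · rw [factorization_eq_zero_of_not_prime _ hprime, pow_zero]
  rw [← prod_filter_of_ne (p := (· ∈ primesLE (2 * N / 3))) fun p hp h => by
    contrapose! h; exact hone hp h]
  calc ∏ p ∈ Ioc (sqrt (2 * N)) N with p ∈ primesLE (2 * N / 3),
        p ^ N.centralBinom.factorization p
      ≤ ∏ p ∈ Ioc (sqrt (2 * N)) N with p ∈ primesLE (2 * N / 3), p := by
        refine prod_le_prod' fun p hp => ?_
        simp only [mem_filter, mem_Ioc] at hp
        refine (pow_right_mono₀ (prime_of_mem_primesLE hp.2).one_lt.le ?_).trans (pow_one p).le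
        exact factorization_choose_le_one (sqrt_lt'.1 hp.1.1)
    _ ≤ ∏ p ∈ primesLE (2 * N / 3), p :=
        prod_le_prod_of_subset_of_one_le' (fun p hp => (mem_filter.1 hp).2)
          fun p hp _ => (prime_of_mem_primesLE hp).one_lt.le

theorem prod_Ioc_pow_factorization_centralBinom_le (hN : 0 < N) :
    ∏ p ∈ Ioc N (2 * N), p ^ N.centralBinom.factorization p ≤
      (2 * N) ^ #{p ∈ Ioc N (2 * N) | p.Prime} := by
  rw [← prod_filter_of_ne (p := Nat.Prime) fun p _ h => by
    contrapose! h; rw [factorization_eq_zero_of_not_prime _ h, pow_zero]]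
  exact prod_le_pow_card _ _ _ fun p _ => pow_factorization_choose_le (by lia)

theorem centralBinom_le_mul_pow_card_primes (hN : 2 < N) :
    centralBinom N ≤ (2 * N) ^ sqrt (2 * N) * 4 ^ (2 * N / 3) *
      (2 * N) ^ #{p ∈ Ioc N (2 * N) | p.Prime} := by
  have hsqrt : sqrt (2 * N) ≤ N := le_of_lt_succ (sqrt_lt.2 (by nlinarith))
  rw [← prod_pow_factorization_centralBinom, range_eq_Ico,
    ← prod_Ico_consecutive _ (Nat.zero_le (N + 1)) (by lia : N + 1 ≤ 2 * N + 1),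
    ← prod_Ico_consecutive _ (Nat.zero_le (sqrt (2 * N) + 1)) (by lia),
    Ico_add_one_add_one_eq_Ioc, Ico_add_one_add_one_eq_Ioc]
  refine Nat.mul_le_mul (Nat.mul_le_mul ?_ ?_) ?_
  · rw [← range_eq_Ico, prod_range_succ', factorization_zero_right, pow_zero, mul_one]
    refine (prod_le_pow_card _ _ (2 * N) fun p _ => ?_).trans (by simp)
    exact pow_factorization_choose_le (by lia)
  · exact prod_Ioc_sqrt_pow_factorization_centralBinom_le hN
  · exact prod_Ioc_pow_factorization_centralBinom_le (by lia)

theorem bitPrimes_succ_eq_filter_Ioc {s : ℕ} (hs : 2 ≤ s) :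
    bitPrimes (s + 1) = {p ∈ Ioc (2 ^ s) (2 * 2 ^ s) | p.Prime} := by
  have hs₀ : ¬ (2 ^ s).Prime := Nat.Prime.not_prime_pow hs
  have hs₁ : ¬ (2 * 2 ^ s).Prime := Nat.not_prime_mul (by norm_num) (by simp; lia)
  ext p
  simp only [bitPrimes, mem_filter, mem_Ico, mem_Ioc, add_tsub_cancel_right, pow_succ']
  grind

theorem card_bitPrimes_pos {s : ℕ} (hs : 2 ≤ s) : 0 < #(bitPrimes (s + 1)) := by
  obtain ⟨p, hp, h⟩ := exists_prime_lt_and_le_two_mul (2 ^ s) (by positivity)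
  rw [bitPrimes_succ_eq_filter_Ioc hs]
  exact card_pos.2 ⟨p, by simp [hp, h]⟩

theorem two_mul_two_pow_lt {s : ℕ} (hs : 2 ≤ s) :
    2 * 2 ^ s < s + (s + 1) * sqrt (2 * 2 ^ s) + 2 * (2 * 2 ^ s / 3) +
      (s + 1) * #(bitPrimes (s + 1)) := by
  have hN : 2 ^ 2 ≤ 2 ^ s := Nat.pow_le_pow_right (by norm_num) hs
  rw [bitPrimes_succ_eq_filter_Ioc hs, ← Nat.pow_lt_pow_iff_right (a := 2) (by norm_num)]
  calc 2 ^ (2 * 2 ^ s) = 4 ^ 2 ^ s := by rw [pow_mul]; norm_num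
    _ < 2 ^ s * centralBinom (2 ^ s) := four_pow_lt_mul_centralBinom (2 ^ s) hN
    _ ≤ 2 ^ s * _ := Nat.mul_le_mul_left _ (centralBinom_le_mul_pow_card_primes (by lia))
    _ = _ := by
      rw [show (4 : ℕ) = 2 ^ 2 by norm_num, ← _root_.pow_succ']
      simp only [← pow_mul, ← pow_add]
      ring_nf

theorem sq_succ_mul_le_two_pow {s : ℕ} (hs : 11 ≤ s) : 25 * (s + 1) ^ 2 ≤ 2 * 2 ^ s := by
  induction s, hs using Nat.le_induction with
  | base => norm_num
  | succ s hs ih => rw [pow_succ 2 s]; nlinarith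

theorem two_pow_le_card_bitPrimes {s : ℕ} (hs : 11 ≤ s) :
    2 ^ s ≤ 4 * (s + 1) * #(bitPrimes (s + 1)) := by
  have hlt := two_mul_two_pow_lt (by lia : 2 ≤ s)
  have hsq := sq_succ_mul_le_two_pow hs
  have hsqrt : 5 * ((s + 1) * sqrt (2 * 2 ^ s)) ≤ 2 * 2 ^ s := by
    refine (Nat.pow_le_pow_iff_left (n := 2) (by norm_num)).1 ?_
    calc _ = 25 * (s + 1) ^ 2 * sqrt (2 * 2 ^ s) ^ 2 := by ring
      _ ≤ (2 * 2 ^ s) * (2 * 2 ^ s) := Nat.mul_le_mul hsq (sqrt_le' _)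
      _ = (2 * 2 ^ s) ^ 2 := by ring
  have hlin : 60 * s ≤ 2 ^ s := by nlinarith
  rw [mul_assoc]
  lia

theorem two_pow_pow_card_dvd_le (s : ℕ) {d : ℕ} (hd : d ≠ 0) :
    (2 ^ s) ^ #{p ∈ bitPrimes (s + 1) | p ∣ d} ≤ d := by
  calc (2 ^ s) ^ #{p ∈ bitPrimes (s + 1) | p ∣ d}
      ≤ ∏ p ∈ bitPrimes (s + 1) with p ∣ d, p := by
        refine pow_card_le_prod _ _ _ fun p hp => ?_
        simp only [bitPrimes, mem_filter, mem_Ico, add_tsub_cancel_right] at hp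
        exact hp.1.1.1
    _ ≤ d := by
        refine le_of_dvd (Nat.pos_of_ne_zero hd) (prod_primes_dvd d (fun p hp => ?_) fun p hp => ?_)
        · simp only [bitPrimes, mem_filter] at hp
          exact hp.1.2.prime
        · exact (mem_filter.1 hp).2

theorem three_le_and_sixteen_le_of_le_choose {n m : ℕ} (hn : 2 ≤ n)
    (h : 2 ^ m * n ^ 2 ≤ n.choose m) : 3 ≤ m ∧ 16 ≤ n := by
  have hm : 3 ≤ m := by
    by_contra hm
    have hle : n.choose m ≤ n ^ 2 :=
      (choose_le_pow n m).trans (Nat.pow_le_pow_right (by lia) (by lia))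
    interval_cases m <;> simp at h hle <;> nlinarith
  refine ⟨hm, ?_⟩
  by_contra hn16
  have hmn : m ≤ n := by
    by_contra hmn
    rw [choose_eq_zero_of_lt (by lia)] at h
    exact absurd h (by simp; lia)
  have hsmall : ∀ n < 16, ∀ m ≤ n, n ≠ 0 → 3 ≤ m → n.choose m < 2 ^ m * n ^ 2 := by decide
  exact absurd h (not_le.2 (hsmall n (by lia) m hmn (by lia) hm))

theorem two_mul_le_of_pow_le_choose {n m s b : ℕ} (hn : 2 ≤ n) (hs : n ^ 2 ≤ 2 ^ s)
    (h : (2 ^ s) ^ b ≤ n.choose m) : 2 * b ≤ m := by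
  refine (Nat.pow_le_pow_iff_right (a := n) (by lia)).1 ?_
  calc n ^ (2 * b) = (n ^ 2) ^ b := pow_mul _ _ _
    _ ≤ (2 ^ s) ^ b := Nat.pow_le_pow_left hs b
    _ ≤ n ^ m := h.trans (choose_le_pow n m)

theorem four_mul_sq_le_two_pow (b : ℕ) : 4 * b ^ 2 ≤ 2 ^ (2 * b) := by
  have hb : 2 * b ≤ 2 ^ b := by
    cases b with
    | zero => simp
    | succ b => rw [pow_succ']; exact Nat.mul_le_mul_left 2 Nat.lt_two_pow_self
  calc 4 * b ^ 2 = (2 * b) ^ 2 := by ring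
    _ ≤ (2 ^ b) ^ 2 := Nat.pow_le_pow_left hb 2
    _ = 2 ^ (2 * b) := by rw [← pow_mul, mul_comm]

theorem mul_sq_le_two_pow_mul {s b n : ℕ} (hs : 11 ≤ s) (hn : 16 ≤ n)
    (hb : 4 * b ^ 2 * n ^ 2 ≤ 2 ^ s) : 4 * (s + 1) * (b * n ^ 2) ≤ 2 ^ s * (n - 2) := by
  have hn' : 8 * n ^ 2 ≤ 25 * (n - 2) ^ 2 := by
    obtain ⟨e, rfl⟩ := Nat.exists_eq_add_of_le hn
    rw [show 16 + e - 2 = 14 + e by lia]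
    nlinarith
  refine (Nat.pow_le_pow_iff_left (n := 2) (by norm_num)).1 ?_
  refine (Nat.mul_le_mul_left_iff (by norm_num : 0 < 200)).1 ?_
  calc 200 * (4 * (s + 1) * (b * n ^ 2)) ^ 2
      = 4 * (25 * (s + 1) ^ 2 * (4 * b ^ 2 * n ^ 2) * (8 * n ^ 2)) := by ring
    _ ≤ 4 * (2 * 2 ^ s * 2 ^ s * (25 * (n - 2) ^ 2)) :=
      Nat.mul_le_mul_left _ (Nat.mul_le_mul (Nat.mul_le_mul (sq_succ_mul_le_two_pow hs) hb) hn')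
    _ = 200 * (2 ^ s * (n - 2)) ^ 2 := by ring

theorem card_bitPrimes_dvd_mul_sq_le {n k m s d : ℕ} (hn : 2 ≤ n) (hmk : m ≤ k)
    (hs : 2 ^ k * n ^ 2 ≤ 2 ^ s) (hd : d ≠ 0) (hdle : d ≤ n.choose m) :
    #{p ∈ bitPrimes (s + 1) | p ∣ d} * n ^ 2 ≤ #(bitPrimes (s + 1)) * (n - 2) := by
  have hchoose := (two_pow_pow_card_dvd_le s hd).trans hdle
  set b := #{p ∈ bitPrimes (s + 1) | p ∣ d}
  rcases Nat.eq_zero_or_pos b with hb | hb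
  · simp [hb]
  have hm2k : 2 ^ m ≤ 2 ^ k := Nat.pow_le_pow_right (by norm_num) hmk
  obtain ⟨hm3, hn16⟩ : 3 ≤ m ∧ 16 ≤ n := three_le_and_sixteen_le_of_le_choose hn <|
    calc 2 ^ m * n ^ 2 ≤ 2 ^ s := (Nat.mul_le_mul_right _ hm2k).trans hs
      _ ≤ n.choose m := (Nat.le_self_pow hb.ne' _).trans hchoose
  have hs11 : 11 ≤ s := by
    refine (Nat.pow_le_pow_iff_right (a := 2) (by norm_num)).1 ?_
    calc 2 ^ 11 = 2 ^ 3 * 16 ^ 2 := by norm_num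
      _ ≤ 2 ^ k * n ^ 2 := Nat.mul_le_mul (Nat.pow_le_pow_right (by norm_num) (by lia))
        (Nat.pow_le_pow_left hn16 2)
      _ ≤ 2 ^ s := hs
  have hbm : 2 * b ≤ m := two_mul_le_of_pow_le_choose hn
    ((Nat.le_mul_of_pos_left _ (by positivity)).trans hs) hchoose
  have hbs : 4 * b ^ 2 * n ^ 2 ≤ 2 ^ s :=
    calc 4 * b ^ 2 * n ^ 2 ≤ 2 ^ k * n ^ 2 := Nat.mul_le_mul_right _ <|
          (four_mul_sq_le_two_pow b).trans (Nat.pow_le_pow_right (by norm_num) (by lia))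
      _ ≤ 2 ^ s := hs
  refine (Nat.mul_le_mul_left_iff (by lia : 0 < 4 * (s + 1))).1 ?_
  calc 4 * (s + 1) * (b * n ^ 2) ≤ 2 ^ s * (n - 2) := mul_sq_le_two_pow_mul hs11 hn16 hbs
    _ ≤ 4 * (s + 1) * #(bitPrimes (s + 1)) * (n - 2) :=
      Nat.mul_le_mul_right _ (two_pow_le_card_bitPrimes hs11)
    _ = 4 * (s + 1) * (#(bitPrimes (s + 1)) * (n - 2)) := mul_assoc _ _ _

theorem exists_primeBits_eq {n : ℕ} (hn : 1 ≤ n) (k : ℕ) :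
    ∃ s, primeBits n k = s + 1 ∧ 2 ^ k * n ^ 2 ≤ 2 ^ s := by
  have hlog : 0 ≤ Real.logb 2 n := Real.logb_nonneg (by norm_num) (by exact_mod_cast hn)
  have hceil : (k : ℝ) + 1 + 2 * Real.logb 2 n ≤ primeBits n k := Nat.le_ceil _
  obtain ⟨s, hs⟩ : ∃ s, primeBits n k = s + 1 :=
    Nat.exists_eq_add_one.2 (Nat.ceil_pos.2 (by positivity))
  rw [hs, Nat.cast_succ] at hceil
  have hpow : (2 : ℝ) ^ ((k : ℝ) + 2 * Real.logb 2 n) ≤ 2 ^ (s : ℝ) :=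
    Real.rpow_le_rpow_of_exponent_le (by norm_num) (by linarith)
  rw [Real.rpow_add (by norm_num), mul_comm 2, Real.rpow_mul (by norm_num),
    Real.rpow_logb (by norm_num) (by norm_num) (by exact_mod_cast hn), Real.rpow_natCast,
    Real.rpow_natCast, Real.rpow_ofNat] at hpow
  exact ⟨s, hs, by exact_mod_cast hpow⟩

end Primes

/-! ### The fingerprint polynomial -/

theorem binOne_succ {m : ℕ} (v : Fin (m + 1) → Fin 2) :
    binOne v = 2 * binOne (Fin.init v) + v (Fin.last m) := by
  have hshift (i : Fin m) : (v i.castSucc : ℕ) * 2 ^ (m + 1 - 1 - (i.castSucc : ℕ)) =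
      2 * (Fin.init v i * 2 ^ (m - 1 - (i : ℕ))) := by
    rw [show m + 1 - 1 - (i.castSucc : ℕ) = m - 1 - (i : ℕ) + 1 by simp; lia, pow_succ, Fin.init]
    ring
  rw [binOne, binOne, Fin.sum_univ_castSucc, Finset.sum_congr rfl fun i _ => hshift i]
  simp [← Finset.mul_sum]
  ring

theorem binOne_lt {m : ℕ} (v : Fin m → Fin 2) : binOne v < 2 ^ (m + 1) := by
  induction m with
  | zero => simp [binOne]
  | succ m ih =>
    have hinit := ih (Fin.init v)
    rw [binOne_succ, pow_succ]
    lia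

theorem log_binOne {m : ℕ} (v : Fin m → Fin 2) : Nat.log 2 (binOne v) = m :=
  Nat.log_eq_of_pow_le_of_lt_pow (Nat.le_add_right _ _) (binOne_lt v)

theorem binOne_injective (m : ℕ) : Function.Injective (binOne : (Fin m → Fin 2) → ℕ) := by
  intro v v' h
  induction m with
  | zero => exact Subsingleton.elim _ _
  | succ m ih =>
    rw [binOne_succ, binOne_succ] at h
    have hinit : Fin.init v = Fin.init v' := ih (by lia)
    have hlast : v (Fin.last m) = v' (Fin.last m) := Fin.ext (by lia)
    rw [← Fin.snoc_init_self v, ← Fin.snoc_init_self v', hinit, hlast]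

theorem coeff_Q {n k m : ℕ} (w : Fin n → Fin 2) (hm : m ∈ Finset.Icc 1 k) (v : Fin m → Fin 2) :
    (Q k w).coeff (binOne v) = binom w v := by
  simp only [Q, Polynomial.finsetSum_coeff, Polynomial.coeff_C_mul_X_pow]
  rw [Finset.sum_eq_single_of_mem m hm, Finset.sum_eq_single v]
  · simp
  · exact fun v' _ hv => if_neg fun h => hv (binOne_injective m h).symm
  · simp
  · refine fun m' _ hm' => Finset.sum_eq_zero fun v' _ => if_neg fun h => hm' ?_
    rw [← log_binOne v', ← h, log_binOne]

theorem natDegree_Q_lt {n : ℕ} (k : ℕ) (w : Fin n → Fin 2) : (Q k w).natDegree < 2 ^ (k + 1) := by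
  refine Nat.lt_of_le_pred (by positivity) ?_
  refine Polynomial.natDegree_sum_le_of_forall_le _ _ fun m hm => ?_
  refine Polynomial.natDegree_sum_le_of_forall_le _ _ fun v _ => ?_
  refine (Polynomial.natDegree_C_mul_X_pow_le _ _).trans (Nat.le_pred_of_lt ?_)
  exact (binOne_lt v).trans_le
    (Nat.pow_le_pow_right (by norm_num) (Nat.succ_le_succ (Finset.mem_Icc.1 hm).2))

theorem BinomEquiv.Q_eq {n k : ℕ} {w₁ w₂ : Fin n → Fin 2} (h : BinomEquiv k w₁ w₂) :
    Q k w₁ = Q k w₂ := by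
  refine Finset.sum_congr rfl fun m hm => Finset.sum_congr rfl fun v _ => ?_
  rw [h m (Finset.mem_Icc.1 hm).2 v]

section Fingerprint

open Polynomial

theorem sub_le_ncard_aeval_ne {f g : ℤ[X]} {p b e : ℕ} (hp : p.Prime) (hf : f.natDegree < b)
    (hg : g.natDegree < b) (hne : ¬ (p : ℤ) ∣ f.coeff e - g.coeff e) :
    p - b ≤ Set.ncard {x : ZMod p | aeval x f ≠ aeval x g} := by
  have := Fact.mk hp
  set h : (ZMod p)[X] := (f - g).map (Int.castRingHom (ZMod p)) with hh
  have h0 : h ≠ 0 := fun h0 => hne <| by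
    rw [← ZMod.intCast_zmod_eq_zero_iff_dvd, ← coeff_sub, ← eq_intCast (Int.castRingHom _),
      ← coeff_map, ← hh, h0, coeff_zero]
  have hdeg : h.natDegree < b :=
    (natDegree_map_le.trans (natDegree_sub_le f g)).trans_lt (max_lt hf hg)
  have hroots : {x : ZMod p | aeval x f ≠ aeval x g}ᶜ = h.roots.toFinset := by
    ext x
    rw [Finset.mem_coe, Multiset.mem_toFinset, mem_roots h0, hh, IsRoot, eval_map]
    simp [sub_eq_zero, aeval_def]
  have hcompl := Set.ncard_add_ncard_compl {x : ZMod p | aeval x f ≠ aeval x g}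
  rw [hroots, Set.ncard_coe_finset, Nat.card_zmod] at hcompl
  have hcard := (Multiset.toFinset_card_le h.roots).trans h.card_roots'
  lia

theorem sub_card_div_card_le_sum_div_card {ι : Type*} {S : Finset ι} (hS : S.Nonempty)
    {P : ι → Prop} [DecidablePred P] {f : ι → ℝ} {a : ℝ} (ha : a ≤ 1) (hf₀ : ∀ i ∈ S, 0 ≤ f i)
    (hf : ∀ i ∈ S, ¬ P i → a ≤ f i) :
    a - ({i ∈ S | P i}.card : ℝ) / S.card ≤ (∑ i ∈ S, f i) / S.card := by
  have hcard : (0 : ℝ) < S.card := by exact_mod_cast hS.card_pos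
  have hterm : ∀ i ∈ S, a - (if P i then 1 else 0) ≤ f i := by
    intro i hi
    split_ifs with h
    · linarith [hf₀ i hi]
    · linarith [hf i hi h]
  have hsum := Finset.sum_le_sum hterm
  rw [Finset.sum_sub_distrib, Finset.sum_const, nsmul_eq_mul, Finset.sum_boole] at hsum
  rw [le_div_iff₀ hcard, sub_mul, div_mul_cancel₀ _ hcard.ne']
  linarith

theorem one_sub_two_div_sq_le_ncard_aeval_Q_ne_div {n k m p : ℕ} {w₁ w₂ : Fin n → Fin 2}
    (hn : 0 < n) (hp : p.Prime) (hle : 2 ^ k * n ^ 2 ≤ p) (hm : m ∈ Finset.Icc 1 k)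
    {v : Fin m → Fin 2} (hv : ¬ (p : ℤ) ∣ binom w₁ v - binom w₂ v) :
    1 - 2 / (n : ℝ) ^ 2 ≤
      (Set.ncard {x : ZMod p | aeval x (Q k w₁) ≠ aeval x (Q k w₂)} : ℝ) / p := by
  have hn₀ : (0 : ℝ) < n := by exact_mod_cast hn
  have hp₀ : (0 : ℝ) < p := by exact_mod_cast hp.pos
  have hcount := sub_le_ncard_aeval_ne (e := binOne v) hp (natDegree_Q_lt k w₁)
    (natDegree_Q_lt k w₂) (by rwa [coeff_Q _ hm, coeff_Q _ hm])
  set N := Set.ncard {x : ZMod p | aeval x (Q k w₁) ≠ aeval x (Q k w₂)}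
  have hN : (p : ℝ) ≤ N + 2 ^ (k + 1) := by exact_mod_cast Nat.sub_le_iff_le_add.1 hcount
  have hdeg : (2 : ℝ) ^ (k + 1) ≤ 2 / (n : ℝ) ^ 2 * p := by
    have hle' : (2 : ℝ) ^ k * n ^ 2 ≤ p := by exact_mod_cast hle
    rw [div_mul_eq_mul_div, le_div_iff₀ (pow_pos hn₀ 2), pow_succ]
    linarith
  rw [le_div_iff₀ hp₀]
  linarith

theorem card_bitPrimes_dvd_div_card_le {n k m s : ℕ} {w₁ w₂ : Fin n → Fin 2} (hn : 2 ≤ n)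
    (hm : m ≤ k) (hle : 2 ^ k * n ^ 2 ≤ 2 ^ s) {v : Fin m → Fin 2}
    (hv : binom w₁ v ≠ binom w₂ v) (hpos : 0 < (bitPrimes (s + 1)).card) :
    (((bitPrimes (s + 1)).filter (· ∣ ((binom w₁ v : ℤ) - binom w₂ v).natAbs)).card : ℝ) /
      (bitPrimes (s + 1)).card ≤ 1 / n - 2 / (n : ℝ) ^ 2 := by
  have hn₀ : (0 : ℝ) < n := by exact_mod_cast (by lia : 0 < n)
  have hd : ((binom w₁ v : ℤ) - binom w₂ v).natAbs ≠ 0 :=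
    Int.natAbs_ne_zero.2 (sub_ne_zero.2 (by exact_mod_cast hv))
  have hdle : ((binom w₁ v : ℤ) - binom w₂ v).natAbs ≤ n.choose m := by
    have h₁ := binom_le_choose w₁ v
    have h₂ := binom_le_choose w₂ v
    lia
  have hcard := card_bitPrimes_dvd_mul_sq_le hn hm hle hd hdle
  have hcast : ((n - 2 : ℕ) : ℝ) = n - 2 := by push_cast [hn]; ring
  have hsplit : 1 / n - 2 / (n : ℝ) ^ 2 = ((n : ℝ) - 2) / n ^ 2 := by field_simp
  rw [hsplit, div_le_div_iff₀ (by exact_mod_cast hpos) (pow_pos hn₀ 2), ← hcast,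
    mul_comm ((n - 2 : ℕ) : ℝ)]
  exact_mod_cast hcard

theorem one_sub_inv_le_fingerprintNoProb_of_ne {n k m : ℕ} {w₁ w₂ : Fin n → Fin 2} (hn : 2 ≤ n)
    (hm : m ∈ Finset.Icc 1 k) {v : Fin m → Fin 2} (hv : binom w₁ v ≠ binom w₂ v) :
    1 - 1 / (n : ℝ) ≤ fingerprintNoProb k w₁ w₂ := by
  obtain ⟨s, hs, hle⟩ := exists_primeBits_eq (by lia : 1 ≤ n) k
  have hs₂ : 2 ≤ s := by
    refine (Nat.pow_le_pow_iff_right (a := 2) (by norm_num)).1 (le_trans ?_ hle)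
    exact (Nat.pow_le_pow_left hn 2).trans (Nat.le_mul_of_pos_left _ (by positivity))
  have hpos := card_bitPrimes_pos hs₂
  have hbad := card_bitPrimes_dvd_div_card_le hn (Finset.mem_Icc.1 hm).2 hle hv hpos
  have haverage := sub_card_div_card_le_sum_div_card (Finset.card_pos.1 hpos)
    (P := (· ∣ ((binom w₁ v : ℤ) - binom w₂ v).natAbs))
    (f := fun p => (Set.ncard {x : ZMod p | aeval x (Q k w₁) ≠ aeval x (Q k w₂)} : ℝ) / p)
    (sub_le_self 1 (by positivity : 0 ≤ 2 / (n : ℝ) ^ 2)) (fun p _ => by positivity)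
    fun p hp hdvd => by
      simp only [bitPrimes, Finset.mem_filter, Finset.mem_Ico, add_tsub_cancel_right] at hp
      exact one_sub_two_div_sq_le_ncard_aeval_Q_ne_div (by lia) hp.2 (hle.trans hp.1.1) hm
        (by rwa [Int.natCast_dvd])
  rw [fingerprintNoProb, hs]
  linarith

theorem one_sub_inv_le_fingerprintNoProb {n k : ℕ} {w₁ w₂ : Fin n → Fin 2}
    (h : ¬ BinomEquiv k w₁ w₂) : 1 - 1 / (n : ℝ) ≤ fingerprintNoProb k w₁ w₂ := by
  obtain ⟨m, hmk, v, hv⟩ : ∃ m ≤ k, ∃ v : Fin m → Fin 2, binom w₁ v ≠ binom w₂ v := by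
    simpa [BinomEquiv] using h
  have hm : 0 < m := Nat.pos_of_ne_zero fun hm => by subst hm; simp at hv
  have hn : 0 < n := Nat.pos_of_ne_zero fun hn => by
    subst hn
    obtain ⟨m, rfl⟩ := Nat.exists_eq_add_one.2 hm
    simp at hv
  rcases (Nat.succ_le_of_lt hn).eq_or_lt with rfl | hn₂
  · rw [Nat.cast_one, div_one, sub_self]
    exact div_nonneg (Finset.sum_nonneg fun p _ => by positivity) (by positivity)
  · exact one_sub_inv_le_fingerprintNoProb_of_ne hn₂ (Finset.mem_Icc.2 ⟨hm, hmk⟩) hv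

end Fingerprint

end KBinomial

namespace WordRAM

open KBinomial

/-! ### Runs of the machine -/

/-- Within `T` steps from `s`, the machine passes through a configuration satisfying `A`. This is
the triple of a program logic with time bounds, with `s` in place of a precondition. -/
def Reach (P : Program) {W : ℕ} (ω : ℕ → Fin (2 ^ W)) (T : ℕ) (A : Config → Prop) (s : Config) :
    Prop :=
  ∃ t ≤ T, A ((step P ω)^[t] s)

/-- The machine is running, at position `pc` and after `u` random words, and its registers and
its memory satisfy `R`. -/
def At (pc u : ℕ) (R : (ℕ → ℕ) → (ℕ → ℕ) → Prop) (s : Config) : Prop :=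
  ∃ reg mem, s = ⟨pc, reg, mem, u, none⟩ ∧ R reg mem

section Reach

variable {P : Program} {W : ℕ} {ω : ℕ → Fin (2 ^ W)} {T T' : ℕ} {A B : Config → Prop} {s : Config}

theorem Reach.refl (h : A s) : Reach P ω T A s := ⟨0, Nat.zero_le _, h⟩

theorem Reach.mono (h : Reach P ω T A s) (hT : T ≤ T') : Reach P ω T' A s :=
  h.imp fun _ ht => ⟨ht.1.trans hT, ht.2⟩

theorem Reach.trans (h : Reach P ω T A s) (h' : ∀ s, A s → Reach P ω T' B s) :
    Reach P ω (T + T') B s := by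
  obtain ⟨t, ht, hA⟩ := h
  obtain ⟨t', ht', hB⟩ := h' _ hA
  exact ⟨t' + t, by lia, by rwa [Function.iterate_add_apply]⟩

theorem Reach.step_of {i : Instr} (hs : s.answer = none) (hP : P[s.pc]? = some i)
    (h : Reach P ω T A (i.exec ω s)) : Reach P ω (T + 1) A s := by
  obtain ⟨t, ht, hA⟩ := h
  refine ⟨t + 1, by lia, ?_⟩
  have hstep : step P ω s = i.exec ω s := by simp [step, hs, hP]
  rwa [Function.iterate_succ_apply, hstep]

variable {pc u d a b l x y z : ℕ} {reg mem : ℕ → ℕ} {R R' : (ℕ → ℕ) → (ℕ → ℕ) → Prop}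

theorem Reach.at_refl (h : R reg mem) : Reach P ω T (At pc u R) ⟨pc, reg, mem, u, none⟩ :=
  Reach.refl ⟨reg, mem, rfl, h⟩

theorem Reach.trans_at (h : Reach P ω T (At pc u R) s)
    (h' : ∀ reg mem, R reg mem → Reach P ω T' A ⟨pc, reg, mem, u, none⟩) :
    Reach P ω (T + T') A s :=
  h.trans fun _ ⟨reg, mem, hs, hR⟩ => hs ▸ h' reg mem hR

theorem Reach.imp_at (h : Reach P ω T (At pc u R) s) (h' : ∀ reg mem, R reg mem → R' reg mem) :
    Reach P ω T (At pc u R') s :=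
  h.trans_at (T' := 0) fun reg mem hR => Reach.at_refl (h' reg mem hR)

theorem Reach.loop_at {c N : ℕ} {v : ℕ → ℕ} {I : ℕ → (ℕ → ℕ) → (ℕ → ℕ) → Prop}
    (hI : ∀ i < N, ∀ reg mem, I i reg mem →
      Reach P ω c (At pc (v (i + 1)) (I (i + 1))) ⟨pc, reg, mem, v i, none⟩)
    (h : I 0 reg mem) : Reach P ω (N * c) (At pc (v N) (I N)) ⟨pc, reg, mem, v 0, none⟩ := by
  induction N with
  | zero => exact Reach.at_refl h
  | succ N ih =>
    rw [Nat.succ_mul]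
    exact (ih fun i hi => hI i (by lia)).trans_at (hI N (by lia))

theorem Reach.const {c : ℕ} (hP : P[pc]? = some (.const d c)) (hc : c < 2 ^ W)
    (h : Reach P ω T A ⟨pc + 1, Function.update reg d c, mem, u, none⟩) :
    Reach P ω (T + 1) A ⟨pc, reg, mem, u, none⟩ :=
  Reach.step_of rfl hP (by simpa only [Instr.exec, Nat.mod_eq_of_lt hc] using h)

theorem Reach.copy (hP : P[pc]? = some (.copy d a)) (ha : reg a = x)
    (h : Reach P ω T A ⟨pc + 1, Function.update reg d x, mem, u, none⟩) :
    Reach P ω (T + 1) A ⟨pc, reg, mem, u, none⟩ :=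
  Reach.step_of rfl hP (by simpa only [Instr.exec, ha] using h)

theorem Reach.op {o : BinOp} (hP : P[pc]? = some (.op o d a b))
    (hz : o.eval W (reg a) (reg b) = z)
    (h : Reach P ω T A ⟨pc + 1, Function.update reg d z, mem, u, none⟩) :
    Reach P ω (T + 1) A ⟨pc, reg, mem, u, none⟩ :=
  Reach.step_of rfl hP (by simpa only [Instr.exec, hz] using h)

theorem Reach.add (hP : P[pc]? = some (.op .add d a b)) (hz : reg a + reg b = z)
    (hlt : z < 2 ^ W) (h : Reach P ω T A ⟨pc + 1, Function.update reg d z, mem, u, none⟩) :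
    Reach P ω (T + 1) A ⟨pc, reg, mem, u, none⟩ :=
  Reach.op hP (by simp only [BinOp.eval, hz, Nat.mod_eq_of_lt hlt]) h

theorem Reach.sub (hP : P[pc]? = some (.op .sub d a b)) (hz : reg a - reg b = z)
    (hlt : z < 2 ^ W) (h : Reach P ω T A ⟨pc + 1, Function.update reg d z, mem, u, none⟩) :
    Reach P ω (T + 1) A ⟨pc, reg, mem, u, none⟩ :=
  Reach.op hP (by simp only [BinOp.eval, hz, Nat.mod_eq_of_lt hlt]) h

theorem Reach.mul (hP : P[pc]? = some (.op .mul d a b)) (hz : reg a * reg b = z)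
    (hlt : z < 2 ^ W) (h : Reach P ω T A ⟨pc + 1, Function.update reg d z, mem, u, none⟩) :
    Reach P ω (T + 1) A ⟨pc, reg, mem, u, none⟩ :=
  Reach.op hP (by simp only [BinOp.eval, hz, Nat.mod_eq_of_lt hlt]) h

theorem Reach.div (hP : P[pc]? = some (.op .div d a b)) (hz : reg a / reg b = z)
    (hlt : z < 2 ^ W) (h : Reach P ω T A ⟨pc + 1, Function.update reg d z, mem, u, none⟩) :
    Reach P ω (T + 1) A ⟨pc, reg, mem, u, none⟩ :=
  Reach.op hP (by simp only [BinOp.eval, hz, Nat.mod_eq_of_lt hlt]) h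

theorem Reach.rem (hP : P[pc]? = some (.op .rem d a b)) (hz : reg a % reg b = z)
    (hlt : z < 2 ^ W) (h : Reach P ω T A ⟨pc + 1, Function.update reg d z, mem, u, none⟩) :
    Reach P ω (T + 1) A ⟨pc, reg, mem, u, none⟩ :=
  Reach.op hP (by simp only [BinOp.eval, hz, Nat.mod_eq_of_lt hlt]) h

theorem Reach.rand (hP : P[pc]? = some (.rand d))
    (h : Reach P ω T A ⟨pc + 1, Function.update reg d (ω u), mem, u + 1, none⟩) :
    Reach P ω (T + 1) A ⟨pc, reg, mem, u, none⟩ :=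
  Reach.step_of rfl hP h

theorem Reach.load (hP : P[pc]? = some (.load d a)) (hx : mem (reg a) = x)
    (h : Reach P ω T A ⟨pc + 1, Function.update reg d x, mem, u, none⟩) :
    Reach P ω (T + 1) A ⟨pc, reg, mem, u, none⟩ :=
  Reach.step_of rfl hP (by simpa only [Instr.exec, hx] using h)

theorem Reach.store (hP : P[pc]? = some (.store a b)) (ha : reg a = x) (hb : reg b = y)
    (h : Reach P ω T A ⟨pc + 1, reg, Function.update mem x y, u, none⟩) :
    Reach P ω (T + 1) A ⟨pc, reg, mem, u, none⟩ :=
  Reach.step_of rfl hP (by simpa only [Instr.exec, ha, hb] using h)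

theorem Reach.jump (hP : P[pc]? = some (.jump l)) (h : Reach P ω T A ⟨l, reg, mem, u, none⟩) :
    Reach P ω (T + 1) A ⟨pc, reg, mem, u, none⟩ :=
  Reach.step_of rfl hP h

theorem Reach.jumpEq_pos (hP : P[pc]? = some (.jumpEq a b l)) (hab : reg a = reg b)
    (h : Reach P ω T A ⟨l, reg, mem, u, none⟩) :
    Reach P ω (T + 1) A ⟨pc, reg, mem, u, none⟩ :=
  Reach.step_of rfl hP (by simpa only [Instr.exec, if_pos hab] using h)

theorem Reach.jumpEq_neg (hP : P[pc]? = some (.jumpEq a b l)) (hab : reg a ≠ reg b)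
    (h : Reach P ω T A ⟨pc + 1, reg, mem, u, none⟩) :
    Reach P ω (T + 1) A ⟨pc, reg, mem, u, none⟩ :=
  Reach.step_of rfl hP (by simpa only [Instr.exec, if_neg hab] using h)

theorem Reach.jumpLt_pos (hP : P[pc]? = some (.jumpLt a b l)) (hab : reg a < reg b)
    (h : Reach P ω T A ⟨l, reg, mem, u, none⟩) :
    Reach P ω (T + 1) A ⟨pc, reg, mem, u, none⟩ :=
  Reach.step_of rfl hP (by simpa only [Instr.exec, if_pos hab] using h)

theorem Reach.jumpLt_neg (hP : P[pc]? = some (.jumpLt a b l)) (hab : ¬ reg a < reg b)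
    (h : Reach P ω T A ⟨pc + 1, reg, mem, u, none⟩) :
    Reach P ω (T + 1) A ⟨pc, reg, mem, u, none⟩ :=
  Reach.step_of rfl hP (by simpa only [Instr.exec, if_neg hab] using h)

theorem Reach.halt {r : Bool} (hP : P[pc]? = some (.halt r)) :
    Reach P ω (T + 1) (fun s => s.answer = some r) ⟨pc, reg, mem, u, none⟩ :=
  Reach.step_of rfl hP (Reach.refl rfl)

theorem answerWithin_of_reach {r : Bool} (h : Reach P ω T (fun s => s.answer = some r) s) :
    answerWithin P ω s T = some r := by
  obtain ⟨t, ht, hA⟩ := h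
  obtain ⟨d, rfl⟩ := Nat.exists_eq_add_of_le ht
  rw [answerWithin, add_comm, Function.iterate_add_apply]
  have hfixed : step P ω ((step P ω)^[t] s) = (step P ω)^[t] s := by simp [step, hA]
  rwa [Function.iterate_fixed hfixed]

theorem eqOn_Iio_update_iff {f g : ℕ → ℕ} {r v : ℕ} (hd : r ≤ d) :
    Set.EqOn (Function.update f d v) g (Set.Iio r) ↔ Set.EqOn f g (Set.Iio r) := by
  refine forall₂_congr fun i hi => ?_
  rw [Function.update_of_ne (LT.lt.ne (lt_of_lt_of_le hi hd))]

end Reach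

/-- `mem` arises from `mem₀` by writing `f 0, …, f (l - 1)` to the cells from `q` on. -/
structure Overwritten (mem₀ : ℕ → ℕ) (q l : ℕ) (f mem : ℕ → ℕ) : Prop where
  inside : ∀ i < l, mem (q + i) = f i
  outside : ∀ a, a < q ∨ q + l ≤ a → mem a = mem₀ a

theorem Overwritten.zero (mem₀ : ℕ → ℕ) (q : ℕ) (f : ℕ → ℕ) : Overwritten mem₀ q 0 f mem₀ :=
  ⟨fun _ hi => absurd hi (Nat.not_lt_zero _), fun _ _ => rfl⟩

theorem Overwritten.succ {mem₀ mem f : ℕ → ℕ} {q l : ℕ} (h : Overwritten mem₀ q l f mem) :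
    Overwritten mem₀ q (l + 1) f (Function.update mem (q + l) (f l)) where
  inside i hi := by
    rcases Nat.lt_succ_iff_lt_or_eq.1 hi with hi | rfl
    · rw [Function.update_of_ne (by lia), h.inside i hi]
    · rw [Function.update_self]
  outside a ha := by rw [Function.update_of_ne (by lia), h.outside a (by lia)]

/-! ### Numbers in base `D` -/

/-- The digit of `y` at place `l` in base `D`. -/
def limb (D y l : ℕ) : ℕ := y / D ^ l % D

/-- The carry into place `l` in the computation of `y + x * z` in base `D`, for a one-digit
number `x`. -/
def carry (D x y z l : ℕ) : ℕ := (y % D ^ l + x * (z % D ^ l)) / D ^ l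

theorem carry_zero (D x y z : ℕ) : carry D x y z 0 = 0 := by simp [carry, Nat.mod_one]

theorem carry_le {D : ℕ} (hD : 0 < D) (x y z l : ℕ) : carry D x y z l ≤ x := by
  have hpos : 0 < D ^ l := by positivity
  refine Nat.lt_succ_iff.1 ((Nat.div_lt_iff_lt_mul hpos).2 ?_)
  have hy := Nat.mod_lt y hpos
  have hz := Nat.mul_le_mul_left x (Nat.mod_lt z hpos).le
  rw [Nat.succ_mul]
  lia

theorem limb_lt {D : ℕ} (hD : 0 < D) (y l : ℕ) : limb D y l < D := Nat.mod_lt _ hD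

theorem mod_pow_succ_add_mul_div {D : ℕ} (hD : 0 < D) (x y z l : ℕ) :
    (y % D ^ (l + 1) + x * (z % D ^ (l + 1))) / D ^ l =
      limb D z l * x + limb D y l + carry D x y z l := by
  have hpos : 0 < D ^ l := by positivity
  rw [Nat.mod_pow_succ, Nat.mod_pow_succ, carry, limb, limb]
  have hsplit : y % D ^ l + D ^ l * (y / D ^ l % D) + x * (z % D ^ l + D ^ l * (z / D ^ l % D)) =
      (y % D ^ l + x * (z % D ^ l)) + D ^ l * (z / D ^ l % D * x + y / D ^ l % D) := by ring
  rw [hsplit, Nat.add_mul_div_left _ _ hpos]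
  ring

theorem carry_succ {D : ℕ} (hD : 0 < D) (x y z l : ℕ) :
    carry D x y z (l + 1) = (limb D z l * x + limb D y l + carry D x y z l) / D := by
  rw [← mod_pow_succ_add_mul_div hD, Nat.div_div_eq_div_mul, carry, pow_succ]

theorem limb_add_mul {D : ℕ} (hD : 0 < D) (x y z l : ℕ) :
    limb D (y + x * z) l = (limb D z l * x + limb D y l + carry D x y z l) % D := by
  rw [← mod_pow_succ_add_mul_div hD, limb]
  have hpos : 0 < D ^ l := by positivity
  have h : y + x * z = (y % D ^ (l + 1) + x * (z % D ^ (l + 1))) +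
      D ^ l * (D * (y / D ^ (l + 1) + x * (z / D ^ (l + 1)))) := by
    conv_lhs => rw [← Nat.mod_add_div y (D ^ (l + 1)), ← Nat.mod_add_div z (D ^ (l + 1))]
    ring
  rw [h, Nat.add_mul_div_left _ _ hpos, Nat.add_mul_mod_self_left]

theorem eq_of_limb_eq {D k y z : ℕ} (hy : y < D ^ k) (hz : z < D ^ k)
    (h : ∀ l < k, limb D y l = limb D z l) : y = z := by
  have hmod (l : ℕ) (hl : l ≤ k) : y % D ^ l = z % D ^ l := by
    induction l with
    | zero => simp [Nat.mod_one]
    | succ l ih =>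
      have hdigit : y / D ^ l % D = z / D ^ l % D := h l hl
      rw [Nat.mod_pow_succ, Nat.mod_pow_succ, ih (by lia), hdigit]
  rw [← Nat.mod_eq_of_lt hy, ← Nat.mod_eq_of_lt hz, hmod k le_rfl]

theorem limb_one {D : ℕ} (hD : 1 < D) (l : ℕ) : limb D 1 l = if l = 0 then 1 else 0 := by
  split_ifs with h
  · simp [h, limb, Nat.mod_eq_of_lt hD]
  · rw [limb, Nat.div_eq_of_lt (Nat.one_lt_pow h hD), Nat.zero_mod]

/-- The memory from the cell `F` on holds the numbers `g 0, …, g k`, each with `k` digits in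
base `D`. -/
def Block (k D : ℕ) (mem : ℕ → ℕ) (F : ℕ) (g : ℕ → ℕ) : Prop :=
  ∀ r ≤ k, ∀ l < k, mem (F + r * k + l) = limb D (g r) l

section Block

variable {k D F F' : ℕ} {mem mem' g g' : ℕ → ℕ}

theorem Block.congr (h : Block k D mem F g)
    (hm : ∀ a, F ≤ a → a < F + (k * k + k) → mem' a = mem a) : Block k D mem' F g := by
  intro r hr l hl
  have hrk : r * k ≤ k * k := Nat.mul_le_mul_right k hr
  rw [hm _ (by lia) (by lia)]
  exact h r hr l hl

theorem Block.update {j v : ℕ} (h : Block k D mem F g)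
    (hm : Overwritten mem (F + j * k) k (limb D v) mem') :
    Block k D mem' F (Function.update g j v) := by
  intro r hr l hl
  rcases lt_trichotomy r j with hrj | rfl | hrj
  · have hrow : (r + 1) * k ≤ j * k := Nat.mul_le_mul_right k hrj
    rw [Function.update_of_ne hrj.ne, hm.outside _ (by lia), h r hr l hl]
  · rw [Function.update_self, hm.inside l hl]
  · have hrow : (j + 1) * k ≤ r * k := Nat.mul_le_mul_right k hrj
    rw [Function.update_of_ne hrj.ne', hm.outside _ (by lia), h r hr l hl]

theorem block_weightedCount_zero {x : ℕ → ℕ → ℕ} {w : ℕ → ℕ} (hD : 1 < D) (h₁ : mem F = 1)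
    (h₀ : ∀ a, F < a → a < F + (k * k + k) → mem a = 0) :
    Block k D mem F (weightedCount x w 0) := by
  intro r hr l hl
  have hrk : r * k ≤ k * k := Nat.mul_le_mul_right k hr
  cases r with
  | zero =>
    rw [weightedCount_zero_right, limb_one hD]
    split_ifs with h
    · simp [h, h₁]
    · exact h₀ _ (by lia) (by lia)
  | succ r =>
    rw [h₀ _ (by lia) (by lia), weightedCount, limb, Nat.zero_div, Nat.zero_mod]

theorem Block.forall_eq_iff (h : Block k D mem F g) (h' : Block k D mem F' g') (hk : 0 < k)
    (hg : ∀ r ≤ k, g r < D ^ k) (hg' : ∀ r ≤ k, g' r < D ^ k) :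
    (∀ r ≤ k, g r = g' r) ↔ ∀ c < k * k + k, mem (F + c) = mem (F' + c) := by
  constructor
  · intro heq c hc
    have hck : c / k ≤ k := by
      rw [← Nat.lt_succ_iff, Nat.div_lt_iff_lt_mul hk, Nat.succ_mul]
      exact hc
    have hdigit := h (c / k) hck (c % k) (Nat.mod_lt _ hk)
    have hdigit' := h' (c / k) hck (c % k) (Nat.mod_lt _ hk)
    rw [add_assoc, Nat.div_add_mod'] at hdigit hdigit'
    rw [hdigit, hdigit', heq _ hck]
  · intro heq r hr
    refine eq_of_limb_eq (hg r hr) (hg' r hr) fun l hl => ?_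
    have hrk : r * k ≤ k * k := Nat.mul_le_mul_right k hr
    rw [← h r hr l hl, ← h' r hr l hl, add_assoc, heq _ (by lia), add_assoc]

end Block

/-! ### The program -/

/-- The Monte-Carlo test for `k`-binomial equivalence. The weights of the letters are random numbers
below `X = 4 ^ s`, where `2 ^ s > n`, and the weighted counts for all lengths up to `k` and both
words are computed as numbers with `k` digits in base `D = 8 ^ s`.

The register `0` holds `n`, `1` holds `k`, `3` holds `1`, `5` holds `X`, and `6` holds `D`. The
letters occupy the memory below the address in register `7`, the counts for the two words start at
the addresses in the registers `7` and `9`, and the table of weights, with `k` entries for each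
letter, at the address in register `10`. -/
def binomTest : Program :=
  [ -- 0: answer at once if `k = 0`
    .const 3 1, .jumpLt 2 1 3, .halt true,
    -- 3: the least power of two greater than `n`
    .const 4 1, .jumpLt 0 4 7, .op .add 4 4 4, .jump 4,
    -- 7: parameters and addresses, counts of the empty factor
    .op .mul 5 4 4, .op .mul 6 5 4, .op .add 7 0 0, .op .mul 8 1 1, .op .add 8 8 1,
    .op .add 9 7 8, .op .add 10 9 8, .store 7 3, .store 9 3,
    -- 16: random weights for the letters that occur
    .jumpEq 12 7 29, .load 13 12, .op .mul 13 13 1, .op .add 13 13 10, .op .add 14 13 1,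
    .jumpEq 13 14 27, .rand 15, .op .rem 15 15 5, .store 13 15, .op .add 13 13 3, .jump 21,
    .op .add 12 12 3, .jump 16,
    -- 29: read the letters of both words
    .const 12 0, .jumpEq 12 7 64, .copy 11 7, .jumpLt 12 0 34, .copy 11 9,
    .load 13 12, .op .mul 13 13 1, .op .add 13 13 10, .op .add 13 13 1, .op .mul 14 1 1,
    .op .add 14 14 11,
    -- 40: update the counts for all lengths, the longest first
    .jumpEq 14 11 62, .op .sub 13 13 3, .load 15 13, .op .sub 16 14 1,
    -- 44: add a multiple of one number to another one
    .const 18 0, .op .add 19 14 1, .copy 20 14, .copy 21 16,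
    .jumpEq 20 19 60, .load 22 21, .op .mul 22 22 15, .load 23 20, .op .add 22 22 23,
    .op .add 22 22 18, .op .rem 23 22 6, .store 20 23, .op .div 18 22 6, .op .add 20 20 3,
    .op .add 21 21 3, .jump 48,
    .copy 14 16, .jump 40,
    .op .add 12 12 3, .jump 30,
    -- 64: compare
    .copy 20 7, .copy 21 9, .jumpEq 20 9 74, .load 22 20, .load 23 21, .jumpEq 22 23 71,
    .halt false, .op .add 20 20 3, .op .add 21 21 3, .jump 66,
    .halt true]

/-- The sizes for which the computation does not overflow. -/
structure Params (σ n k W X D : ℕ) : Prop where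
  k_pos : 0 < k
  k_le : k ≤ n
  X_pos : 0 < X
  D_pos : 0 < D
  one_lt : 1 < 2 ^ W
  mul_lt : n * X < D
  digit_lt : D * X + D + X < 2 ^ W
  addr_lt : n + n + 2 * (k * k + k) + σ * k + k < 2 ^ W

/-- The contents of the registers that do not change after the initialisation. -/
structure Env (n k X D : ℕ) (reg : ℕ → ℕ) : Prop where
  r0 : reg 0 = n
  r1 : reg 1 = k
  r3 : reg 3 = 1
  r5 : reg 5 = X
  r6 : reg 6 = D
  r7 : reg 7 = n + n
  r9 : reg 9 = n + n + (k * k + k)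
  r10 : reg 10 = n + n + (k * k + k) + (k * k + k)

theorem Env.congr {n k X D r : ℕ} {reg reg' : ℕ → ℕ} (h : Env n k X D reg)
    (heq : Set.EqOn reg' reg (Set.Iio r)) (hr : 11 ≤ r) : Env n k X D reg' where
  r0 := (heq (Set.mem_Iio.2 (by lia))).trans h.r0
  r1 := (heq (Set.mem_Iio.2 (by lia))).trans h.r1
  r3 := (heq (Set.mem_Iio.2 (by lia))).trans h.r3
  r5 := (heq (Set.mem_Iio.2 (by lia))).trans h.r5
  r6 := (heq (Set.mem_Iio.2 (by lia))).trans h.r6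
  r7 := (heq (Set.mem_Iio.2 (by lia))).trans h.r7
  r9 := (heq (Set.mem_Iio.2 (by lia))).trans h.r9
  r10 := (heq (Set.mem_Iio.2 (by lia))).trans h.r10

section AddMul

variable {σ n k W X D src dst x y z u : ℕ} {ω : ℕ → Fin (2 ^ W)} {reg₀ mem₀ reg mem : ℕ → ℕ}

/-- The loop invariant of the multi-digit operation `y ← y + x * z`, after `l` digits. -/
structure AddMulInv (k D src dst x y z : ℕ) (reg₀ mem₀ : ℕ → ℕ) (l : ℕ) (reg mem : ℕ → ℕ) :
    Prop where
  frame : Set.EqOn reg reg₀ (Set.Iio 18)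
  r18 : reg 18 = carry D x y z l
  r19 : reg 19 = dst + k
  r20 : reg 20 = dst + l
  r21 : reg 21 = src + l
  written : Overwritten mem₀ dst l (limb D (y + x * z)) mem

theorem AddMulInv.step (hp : Params σ n k W X D) (hE : Env n k X D reg₀) (hx : x < X)
    (hsrc : src + k ≤ dst) (hdst : dst + k < 2 ^ W) (h15 : reg₀ 15 = x)
    (hy : ∀ l < k, mem₀ (dst + l) = limb D y l) (hz : ∀ l < k, mem₀ (src + l) = limb D z l)
    {l : ℕ} (hl : l < k) (h : AddMulInv k D src dst x y z reg₀ mem₀ l reg mem) :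
    Reach binomTest ω 12 (At 48 u (AddMulInv k D src dst x y z reg₀ mem₀ (l + 1)))
      ⟨48, reg, mem, u, none⟩ := by
  have hE' := hE.congr h.frame (by lia)
  have hD := hp.D_pos
  have hr15 : reg 15 = x := (h.frame (Set.mem_Iio.2 (by lia))).trans h15
  have hzl : mem (src + l) = limb D z l := by rw [h.written.outside _ (by lia), hz l hl]
  have hyl : mem (dst + l) = limb D y l := by rw [h.written.outside _ (by lia), hy l hl]
  have hcarry := carry_le hD x y z l
  have hly := limb_lt hD y l
  have hprod : limb D z l * x ≤ D * X := Nat.mul_le_mul (limb_lt hD z l).le hx.le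
  have hdig := hp.digit_lt
  refine Reach.jumpEq_neg rfl (by rw [h.r20, h.r19]; lia) ?_
  refine Reach.load (x := limb D z l) rfl (by rw [h.r21, hzl]) ?_
  refine Reach.mul (z := limb D z l * x) rfl (by simp [hr15]) (by lia) ?_
  refine Reach.load (x := limb D y l) rfl (by simp [h.r20, hyl]) ?_
  refine Reach.add (z := limb D z l * x + limb D y l) rfl (by simp) (by lia) ?_
  refine Reach.add (z := limb D z l * x + limb D y l + carry D x y z l) rfl (by simp [h.r18])
    (by lia) ?_
  refine Reach.rem (z := limb D (y + x * z) l) rfl (by simp [hE'.r6, limb_add_mul hD])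
    ((limb_lt hD _ _).trans (by lia)) ?_
  refine Reach.store (x := dst + l) (y := limb D (y + x * z) l) rfl (by simp [h.r20]) (by simp) ?_
  refine Reach.div (z := carry D x y z (l + 1)) rfl (by simp [hE'.r6, carry_succ hD])
    ((carry_le hD x y z _).trans_lt (by lia)) ?_
  refine Reach.add (z := dst + (l + 1)) rfl (by simp [h.r20, hE'.r3, add_assoc]) (by lia) ?_
  refine Reach.add (z := src + (l + 1)) rfl (by simp [h.r21, hE'.r3, add_assoc]) (by lia) ?_
  refine Reach.jump rfl (Reach.at_refl ⟨?_, ?_, ?_, ?_, ?_, h.written.succ⟩)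
  · simpa [eqOn_Iio_update_iff] using h.frame
  all_goals simp [h.r19]

theorem reach_addMul (hp : Params σ n k W X D) (hE : Env n k X D reg₀) (hx : x < X)
    (hsrc : src + k ≤ dst) (hdst : dst + k < 2 ^ W) (h14 : reg₀ 14 = dst) (h15 : reg₀ 15 = x)
    (h16 : reg₀ 16 = src) (hy : ∀ l < k, mem₀ (dst + l) = limb D y l)
    (hz : ∀ l < k, mem₀ (src + l) = limb D z l) :
    Reach binomTest ω (k * 12 + 5)
      (At 60 u fun reg mem => Set.EqOn reg reg₀ (Set.Iio 18) ∧
        Overwritten mem₀ dst k (limb D (y + x * z)) mem)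
      ⟨44, reg₀, mem₀, u, none⟩ := by
  have hone := hp.one_lt
  refine Reach.const rfl (by lia) ?_
  refine Reach.add (z := dst + k) rfl (by simp [h14, hE.r1]) hdst ?_
  refine Reach.copy (x := dst) rfl (by simp [h14]) ?_
  refine Reach.copy (x := src) rfl (by simp [h16]) ?_
  refine (Reach.loop_at (v := fun _ => u) (I := AddMulInv k D src dst x y z reg₀ mem₀)
    (fun l hl reg mem h => h.step hp hE hx hsrc hdst h15 hy hz hl) ?_).trans_at ?_
  · refine ⟨?_, ?_, ?_, ?_, ?_, Overwritten.zero _ _ _⟩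
    · simp [eqOn_Iio_update_iff, Set.eqOn_refl]
    all_goals simp [carry_zero]
  · intro reg mem h
    exact Reach.jumpEq_pos rfl (by rw [h.r20, h.r19]) (Reach.at_refl ⟨h.frame, h.written⟩)

end AddMul

section Update

variable {σ n k W X D F t u : ℕ} {ω : ℕ → Fin (2 ^ W)} {reg₀ mem₀ reg mem g g' x : ℕ → ℕ}

/-- The loop invariant of the replacement of `g` by `g'` in the block at `F`, when only the numbers
with index at most `j` are still to be treated. -/
structure UpdateInv (k D F t : ℕ) (g g' reg₀ mem₀ : ℕ → ℕ) (j : ℕ) (reg mem : ℕ → ℕ) : Prop where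
  frame : Set.EqOn reg reg₀ (Set.Iio 13)
  r13 : reg 13 = t + j
  r14 : reg 14 = F + j * k
  outside : ∀ a, a < F ∨ F + (k * k + k) ≤ a → mem a = mem₀ a
  block : Block k D mem F fun r => if j < r then g' r else g r

theorem UpdateInv.update {j : ℕ} {reg' mem' : ℕ → ℕ} (hj : j < k)
    (h : UpdateInv k D F t g g' reg₀ mem₀ (j + 1) reg mem)
    (hfr : Set.EqOn reg' reg (Set.Iio 13)) (h13 : reg' 13 = t + j) (h14 : reg' 14 = F + j * k)
    (hm : Overwritten mem (F + (j + 1) * k) k (limb D (g' (j + 1))) mem') :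
    UpdateInv k D F t g g' reg₀ mem₀ j reg' mem' where
  frame := hfr.trans h.frame
  r13 := h13
  r14 := h14
  outside a ha := by
    have hjk : (j + 1) * k ≤ k * k := Nat.mul_le_mul_right k hj
    rw [hm.outside a (by lia), h.outside a ha]
  block := by
    convert h.block.update hm using 1
    funext r
    simp only [Function.update_apply]
    grind

theorem UpdateInv.step (hp : Params σ n k W X D) (hE : Env n k X D reg₀) (ht : t + k < 2 ^ W)
    (hFt : F + (k * k + k) ≤ t) (h11 : reg₀ 11 = F) (hx : ∀ j < k, x j < X)
    (hmx : ∀ j < k, mem₀ (t + j) = x j) (hg : ∀ j < k, g' (j + 1) = g (j + 1) + x j * g j)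
    {j : ℕ} (hj : j < k) (h : UpdateInv k D F t g g' reg₀ mem₀ (j + 1) reg mem) :
    Reach binomTest ω (k * 12 + 11) (At 40 u (UpdateInv k D F t g g' reg₀ mem₀ j))
      ⟨40, reg, mem, u, none⟩ := by
  have hE' := hE.congr h.frame (by lia)
  have hkpos := hp.k_pos
  have hjk : (j + 1) * k ≤ k * k := Nat.mul_le_mul_right k hj
  have hr11 : reg 11 = F := (h.frame (Set.mem_Iio.2 (by lia))).trans h11
  refine Reach.jumpEq_neg rfl (by rw [h.r14, hr11]; lia) ?_
  refine Reach.sub (z := t + j) rfl (by simp [h.r13, hE'.r3]) (by lia) ?_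
  refine Reach.load (x := x j) rfl (by simp [h.outside (t + j) (by lia), hmx j hj]) ?_
  refine Reach.sub (z := F + j * k) rfl ?_ (by lia) ?_
  · simp [h.r14, hE'.r1, Nat.succ_mul, ← add_assoc]
  change Reach binomTest ω (k * 12 + 5 + 2) _ _
  refine (reach_addMul hp (src := F + j * k) (dst := F + (j + 1) * k) (x := x j) (y := g (j + 1))
    (z := g j) (hE'.congr (r := 13) ?_ (by lia)) (hx j hj) (by lia) (by lia) ?_ ?_ ?_ ?_
    ?_).trans_at ?_
  · simp [eqOn_Iio_update_iff, Set.eqOn_refl]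
  · simp [h.r14]
  · simp
  · simp
  · intro l hl
    simpa using h.block (j + 1) hj l hl
  · intro l hl
    simpa using h.block j hj.le l hl
  · rintro reg' mem' ⟨hfr, hm⟩
    refine Reach.copy (x := F + j * k) rfl (by simp [hfr (Set.mem_Iio.2 (by lia : 16 < 18))]) ?_
    refine Reach.jump rfl (Reach.at_refl (h.update hj ?_ ?_ ?_ ?_))
    · refine (Set.EqOn.trans ?_ (hfr.mono (Set.Iio_subset_Iio (by lia)))).trans ?_ <;>
        simp [eqOn_Iio_update_iff, Set.eqOn_refl]
    · simp [hfr (Set.mem_Iio.2 (by lia : 13 < 18))]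
    · simp
    · rwa [hg j hj]

theorem reach_update (hp : Params σ n k W X D) (hE : Env n k X D reg₀) (ht : t + k < 2 ^ W)
    (hFt : F + (k * k + k) ≤ t) (h11 : reg₀ 11 = F) (h13 : reg₀ 13 = t + k)
    (h14 : reg₀ 14 = F + k * k) (hx : ∀ j < k, x j < X) (hmx : ∀ j < k, mem₀ (t + j) = x j)
    (hB : Block k D mem₀ F g) (hg₀ : g' 0 = g 0)
    (hg : ∀ j < k, g' (j + 1) = g (j + 1) + x j * g j) :
    Reach binomTest ω (k * (k * 12 + 11) + 1)
      (At 62 u fun reg mem => Set.EqOn reg reg₀ (Set.Iio 13) ∧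
        (∀ a, a < F ∨ F + (k * k + k) ≤ a → mem a = mem₀ a) ∧ Block k D mem F g')
      ⟨40, reg₀, mem₀, u, none⟩ := by
  refine (Reach.loop_at (v := fun _ => u)
    (I := fun i => UpdateInv k D F t g g' reg₀ mem₀ (k - i)) ?_ ?_).trans_at ?_
  · intro i hi reg mem h
    rw [show k - i = k - (i + 1) + 1 by lia] at h
    exact h.step hp hE ht hFt h11 hx hmx hg (by lia)
  · refine ⟨Set.eqOn_refl _ _, h13, h14, fun _ _ => rfl, fun r hr l hl => ?_⟩
    simpa [hr.not_gt] using hB r hr l hl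
  · intro reg mem h
    refine Reach.jumpEq_pos rfl ?_ (Reach.at_refl ⟨h.frame, h.outside, fun r hr l hl => ?_⟩)
    · rw [h.r14, h.frame (Set.mem_Iio.2 (by lia)), h11]
      simp
    · rw [h.block r hr l hl]
      grind

end Update

/-- The last place before `i` at which the letter `a` occurs in `w`, and `0` if there is none. -/
def lastPos (w : ℕ → ℕ) : ℕ → ℕ → ℕ
  | 0, _ => 0
  | i + 1, a => if w i = a then i else lastPos w i a

theorem lastPos_spec {w : ℕ → ℕ} {N i : ℕ} (hi : i < N) :
    lastPos w N (w i) < N ∧ w (lastPos w N (w i)) = w i := by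
  induction N with
  | zero => lia
  | succ N ih =>
    rw [lastPos]
    split_ifs with h
    · exact ⟨Nat.lt_succ_self N, h⟩
    · have hiN : i < N := by grind
      exact ⟨(ih hiN).1.trans (Nat.lt_succ_self N), (ih hiN).2⟩

/-- The weight of the letter `a` in the `j`-th row when each of the first `N` letters of `w` has
drawn `k` random words: a later occurrence of a letter overwrites the weights of an earlier one. -/
def weight {W : ℕ} (ω : ℕ → Fin (2 ^ W)) (k X : ℕ) (w : ℕ → ℕ) (N a j : ℕ) : ℕ :=
  (ω (lastPos w N a * k + j) : ℕ) % X

section Weights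

variable {σ n k W X D t u : ℕ} {ω : ℕ → Fin (2 ^ W)} {w reg₀ mem₀ reg mem : ℕ → ℕ}

theorem weight_lt (hX : 0 < X) (N a j : ℕ) : weight ω k X w N a j < X := Nat.mod_lt _ hX

/-- The loop invariant of the choice of a row of random weights, after `j` entries. -/
structure RandomRowInv (ω : ℕ → Fin (2 ^ W)) (k X t u : ℕ) (reg₀ mem₀ : ℕ → ℕ) (j : ℕ)
    (reg mem : ℕ → ℕ) : Prop where
  frame : Set.EqOn reg reg₀ (Set.Iio 13)
  r13 : reg 13 = t + j
  r14 : reg 14 = t + k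
  written : Overwritten mem₀ t j (fun l => (ω (u + l) : ℕ) % X) mem

theorem RandomRowInv.step (hE : Env n k X D reg₀) (ht : t + k < 2 ^ W)
    {j : ℕ} (hj : j < k) (h : RandomRowInv ω k X t u reg₀ mem₀ j reg mem) :
    Reach binomTest ω 6 (At 21 (u + (j + 1)) (RandomRowInv ω k X t u reg₀ mem₀ (j + 1)))
      ⟨21, reg, mem, u + j, none⟩ := by
  have hE' := hE.congr h.frame (by lia)
  refine Reach.jumpEq_neg rfl (by rw [h.r13, h.r14]; lia) ?_
  refine Reach.rand rfl ?_
  refine Reach.rem (z := (ω (u + j) : ℕ) % X) rfl (by simp [hE'.r5])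
    ((Nat.mod_le _ _).trans_lt (ω _).isLt) ?_
  refine Reach.store (x := t + j) (y := (ω (u + j) : ℕ) % X) rfl (by simp [h.r13]) (by simp) ?_
  refine Reach.add (z := t + (j + 1)) rfl (by simp [h.r13, hE'.r3, add_assoc]) (by lia) ?_
  refine Reach.jump rfl (Reach.at_refl ⟨?_, ?_, ?_, h.written.succ⟩)
  · simpa [eqOn_Iio_update_iff] using h.frame
  · simp
  · simp [h.r14]

theorem reach_randomRow (hE : Env n k X D reg₀) (ht : t + k < 2 ^ W) (h13 : reg₀ 13 = t)
    (h14 : reg₀ 14 = t + k) :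
    Reach binomTest ω (k * 6 + 1)
      (At 27 (u + k) fun reg mem => Set.EqOn reg reg₀ (Set.Iio 13) ∧
        Overwritten mem₀ t k (fun l => (ω (u + l) : ℕ) % X) mem)
      ⟨21, reg₀, mem₀, u, none⟩ := by
  refine (Reach.loop_at (v := fun j => u + j) (I := RandomRowInv ω k X t u reg₀ mem₀)
    (fun j hj reg mem h => h.step hE ht hj) ?_).trans_at ?_
  · exact ⟨Set.eqOn_refl _ _, h13, h14, Overwritten.zero _ _ _⟩
  · intro reg mem h
    exact Reach.jumpEq_pos rfl (by rw [h.r13, h.r14]) (Reach.at_refl ⟨h.frame, h.written⟩)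

/-- The loop invariant of the choice of all weights, after `i` letters. -/
structure WeightsInv (ω : ℕ → Fin (2 ^ W)) (n k X D : ℕ) (w mem₀ : ℕ → ℕ) (i : ℕ)
    (reg mem : ℕ → ℕ) : Prop where
  env : Env n k X D reg
  r12 : reg 12 = i
  low : ∀ a < n + n + (k * k + k) + (k * k + k), mem a = mem₀ a
  table : ∀ i' < i, ∀ j < k,
    mem (n + n + (k * k + k) + (k * k + k) + w i' * k + j) = weight ω k X w i (w i') j

theorem WeightsInv.update {i : ℕ} {reg' mem' : ℕ → ℕ} (h : WeightsInv ω n k X D w mem₀ i reg mem)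
    (hE : Env n k X D reg') (h12 : reg' 12 = i + 1)
    (hm : Overwritten mem (n + n + (k * k + k) + (k * k + k) + w i * k) k
      (fun l => (ω (i * k + l) : ℕ) % X) mem') :
    WeightsInv ω n k X D w mem₀ (i + 1) reg' mem' where
  env := hE
  r12 := h12
  low a ha := by rw [hm.outside _ (by lia), h.low a ha]
  table i' hi' j hj := by
    rw [weight, lastPos]
    rcases lt_trichotomy (w i') (w i) with hlt | heq | hlt
    · have hrow : (w i' + 1) * k ≤ w i * k := Nat.mul_le_mul_right k hlt
      rw [if_neg hlt.ne', hm.outside _ (by lia), h.table i' (by grind) j hj, weight]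
    · rw [if_pos heq.symm, heq, hm.inside j hj]
    · have hrow : (w i + 1) * k ≤ w i' * k := Nat.mul_le_mul_right k hlt
      rw [if_neg hlt.ne, hm.outside _ (by lia), h.table i' (by grind) j hj, weight]

theorem WeightsInv.step (hp : Params σ n k W X D) (hw : ∀ i < n + n, mem₀ i = w i)
    (hwσ : ∀ i < n + n, w i < σ) {i : ℕ} (hi : i < n + n)
    (h : WeightsInv ω n k X D w mem₀ i reg mem) :
    Reach binomTest ω (k * 6 + 8) (At 16 ((i + 1) * k) (WeightsInv ω n k X D w mem₀ (i + 1)))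
      ⟨16, reg, mem, i * k, none⟩ := by
  have haddr := hp.addr_lt
  have hrow : (w i + 1) * k ≤ σ * k := Nat.mul_le_mul_right k (hwσ i hi)
  refine Reach.jumpEq_neg rfl (by rw [h.r12, h.env.r7]; lia) ?_
  refine Reach.load (x := w i) rfl (by rw [h.r12, h.low i (by lia), hw i hi]) ?_
  refine Reach.mul (z := w i * k) rfl (by simp [h.env.r1]) (by lia) ?_
  refine Reach.add (z := n + n + (k * k + k) + (k * k + k) + w i * k) rfl
    (by simp [h.env.r10, add_comm]) (by lia) ?_
  refine Reach.add (z := n + n + (k * k + k) + (k * k + k) + w i * k + k) rfl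
    (by simp [h.env.r1]) (by lia) ?_
  change Reach binomTest ω (k * 6 + 1 + 2) _ _
  refine (reach_randomRow (t := n + n + (k * k + k) + (k * k + k) + w i * k)
    (h.env.congr (r := 13) ?_ (by lia)) (by lia) (by simp) (by simp)).trans_at ?_
  · simp [eqOn_Iio_update_iff, Set.eqOn_refl]
  · rintro reg' mem' ⟨hfr, hm⟩
    have hfr' : Set.EqOn reg' reg (Set.Iio 13) := by
      refine hfr.trans ?_
      simp [eqOn_Iio_update_iff, Set.eqOn_refl]
    have hE' := h.env.congr hfr' (by lia)
    refine Reach.add (z := i + 1) rfl ?_ (by lia) ?_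
    · rw [hE'.r3, hfr' (Set.mem_Iio.2 (by lia)), h.r12]
    · rw [← Nat.succ_mul]
      refine Reach.jump rfl (Reach.at_refl (h.update (hE'.congr (r := 12) ?_ (by lia)) ?_ hm))
      · simp [eqOn_Iio_update_iff, Set.eqOn_refl]
      · simp

theorem reach_weights (hp : Params σ n k W X D) (hE : Env n k X D reg₀) (h12 : reg₀ 12 = 0)
    (hw : ∀ i < n + n, mem₀ i = w i) (hwσ : ∀ i < n + n, w i < σ) :
    Reach binomTest ω ((n + n) * (k * 6 + 8) + 1)
      (At 29 ((n + n) * k) (WeightsInv ω n k X D w mem₀ (n + n)))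
      ⟨16, reg₀, mem₀, 0, none⟩ := by
  rw [← zero_mul k]
  refine (Reach.loop_at (v := fun i => i * k) (I := WeightsInv ω n k X D w mem₀)
    (fun i hi reg mem h => h.step hp hw hwσ hi) ?_).trans_at ?_
  · exact ⟨hE, h12, fun _ _ => rfl, fun i' hi' => absurd hi' (Nat.not_lt_zero _)⟩
  · intro reg mem h
    exact Reach.jumpEq_pos rfl (by rw [h.r12, h.env.r7]) (Reach.at_refl h)

end Weights

section Counts

variable {σ n k W X D F a i u : ℕ} {ω : ℕ → Fin (2 ^ W)} {w reg₀ mem₀ reg mem g g' : ℕ → ℕ}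
  {x : ℕ → ℕ → ℕ}

theorem reach_select (hE : Env n k X D reg) (h12 : reg 12 = i) (hi : i < n + n) :
    Reach binomTest ω 4
      (At 34 u fun reg' mem' => Set.EqOn reg' reg (Set.Iio 11) ∧
        reg' 11 = (if i < n then n + n else n + n + (k * k + k)) ∧ reg' 12 = i ∧ mem' = mem)
      ⟨30, reg, mem, u, none⟩ := by
  refine Reach.jumpEq_neg rfl (by rw [h12, hE.r7]; lia) ?_
  refine Reach.copy (x := n + n) rfl hE.r7 ?_
  by_cases hin : i < n
  · refine Reach.jumpLt_pos rfl (by simpa [h12, hE.r0]) (Reach.at_refl ⟨?_, ?_, ?_, rfl⟩)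
    · simp [eqOn_Iio_update_iff, Set.eqOn_refl]
    · simp [hin]
    · simp [h12]
  · refine Reach.jumpLt_neg rfl (by simpa [h12, hE.r0] using hin) ?_
    refine Reach.copy (x := n + n + (k * k + k)) rfl (by simp [hE.r9]) ?_
    refine Reach.at_refl ⟨?_, ?_, ?_, rfl⟩
    · simp [eqOn_Iio_update_iff, Set.eqOn_refl]
    · simp [hin]
    · simp [h12]

theorem reach_letter (hp : Params σ n k W X D) (hE : Env n k X D reg₀) (h11 : reg₀ 11 = F)
    (h12 : reg₀ 12 = i) (hi : i < n + n) (ha : a < σ) (hmi : mem₀ i = a)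
    (hF : F + (k * k + k) ≤ n + n + (k * k + k) + (k * k + k)) (hx : ∀ j < k, x a j < X)
    (hrow : ∀ j < k, mem₀ (n + n + (k * k + k) + (k * k + k) + a * k + j) = x a j)
    (hB : Block k D mem₀ F g) (hg₀ : g' 0 = g 0)
    (hg : ∀ j < k, g' (j + 1) = g (j + 1) + x a j * g j) :
    Reach binomTest ω (k * (k * 12 + 11) + 9)
      (At 30 u fun reg mem => Set.EqOn reg reg₀ (Set.Iio 12) ∧ reg 12 = i + 1 ∧
        (∀ c, c < F ∨ F + (k * k + k) ≤ c → mem c = mem₀ c) ∧ Block k D mem F g')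
      ⟨34, reg₀, mem₀, u, none⟩ := by
  have haddr := hp.addr_lt
  have hkpos := hp.k_pos
  have hak : (a + 1) * k ≤ σ * k := Nat.mul_le_mul_right k ha
  refine Reach.load (x := a) rfl (by rw [h12, hmi]) ?_
  refine Reach.mul (z := a * k) rfl (by simp [hE.r1]) (by lia) ?_
  refine Reach.add (z := n + n + (k * k + k) + (k * k + k) + a * k) rfl
    (by simp [hE.r10, add_comm]) (by lia) ?_
  refine Reach.add (z := n + n + (k * k + k) + (k * k + k) + a * k + k) rfl
    (by simp [hE.r1]) (by lia) ?_
  refine Reach.mul (z := k * k) rfl (by simp [hE.r1]) (by lia) ?_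
  refine Reach.add (z := F + k * k) rfl (by simp [h11, add_comm]) (by lia) ?_
  change Reach binomTest ω (k * (k * 12 + 11) + 1 + 2) _ _
  refine (reach_update hp (hE.congr (r := 13) ?_ (by lia)) (by lia) (by lia) (by simp [h11])
    (by simp) (by simp) hx hrow hB hg₀ hg).trans_at ?_
  · simp [eqOn_Iio_update_iff, Set.eqOn_refl]
  · rintro reg mem ⟨hfr, hout, hB'⟩
    have hfr' : Set.EqOn reg reg₀ (Set.Iio 13) := by
      refine hfr.trans ?_
      simp [eqOn_Iio_update_iff, Set.eqOn_refl]
    refine Reach.add (z := i + 1) rfl ?_ (by lia) ?_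
    · rw [(hE.congr hfr' (by lia)).r3, hfr' (Set.mem_Iio.2 (by lia)), h12]
    · refine Reach.jump rfl (Reach.at_refl ⟨?_, ?_, hout, hB'⟩)
      · simpa [eqOn_Iio_update_iff] using hfr'.mono (Set.Iio_subset_Iio (by lia))
      · simp

/-- The loop invariant of the computation of the weighted counts, after `i` letters of the two
words. -/
structure CountsInv (n k X D : ℕ) (x : ℕ → ℕ → ℕ) (w mem₀ : ℕ → ℕ) (i : ℕ) (reg mem : ℕ → ℕ) :
    Prop where
  env : Env n k X D reg
  r12 : reg 12 = i
  outside : ∀ c, c < n + n ∨ n + n + (k * k + k) + (k * k + k) ≤ c → mem c = mem₀ c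
  left : Block k D mem (n + n) (weightedCount x w (min i n))
  right : Block k D mem (n + n + (k * k + k)) (weightedCount x (fun a => w (n + a)) (i - n))

theorem CountsInv.step (hp : Params σ n k W X D) (hw : ∀ i < n + n, mem₀ i = w i)
    (hwσ : ∀ i < n + n, w i < σ) (hx : ∀ a j, x a j < X)
    (htab : ∀ i < n + n, ∀ j < k,
      mem₀ (n + n + (k * k + k) + (k * k + k) + w i * k + j) = x (w i) j)
    {i : ℕ} (hi : i < n + n) (h : CountsInv n k X D x w mem₀ i reg mem) :
    Reach binomTest ω (k * (k * 12 + 11) + 13) (At 30 u (CountsInv n k X D x w mem₀ (i + 1)))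
      ⟨30, reg, mem, u, none⟩ := by
  rw [show k * (k * 12 + 11) + 13 = 4 + (k * (k * 12 + 11) + 9) by ring]
  refine (reach_select h.env h.r12 hi).trans_at ?_
  rintro reg' mem ⟨hfr, h11, h12, rfl⟩
  have hE' := h.env.congr hfr le_rfl
  have hmi : mem i = w i := by rw [h.outside i (by lia), hw i hi]
  have hrow : ∀ j < k, mem (n + n + (k * k + k) + (k * k + k) + w i * k + j) = x (w i) j :=
    fun j hj => by rw [h.outside _ (by lia), htab i hi j hj]
  split_ifs at h11 with hin
  · have hB := h.left
    rw [min_eq_left hin.le] at hB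
    refine (reach_letter (g' := weightedCount x w (i + 1)) hp hE' h11 h12 hi (hwσ i hi) hmi
      (by lia) (fun j _ => hx _ j) hrow hB (by simp) fun j _ => rfl).imp_at ?_
    rintro reg mem' ⟨hfr', h12', hout, hB'⟩
    refine ⟨hE'.congr hfr' (by lia), h12', fun c hc => ?_, ?_, ?_⟩
    · rw [hout c (by lia), h.outside c hc]
    · rwa [min_eq_left (Nat.succ_le_of_lt hin)]
    · rw [show i + 1 - n = i - n by lia]
      exact h.right.congr fun c h₁ _ => hout c (by lia)
  · have hni : n + (i - n) = i := by lia
    refine (reach_letter (g' := weightedCount x (fun a => w (n + a)) (i - n + 1)) hp hE' h11 h12 hi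
      (hwσ i hi) hmi (by lia) (fun j _ => hx _ j) hrow h.right (by simp)
      fun j _ => by rw [weightedCount, hni]).imp_at ?_
    rintro reg mem' ⟨hfr', h12', hout, hB'⟩
    refine ⟨hE'.congr hfr' (by lia), h12', fun c hc => ?_, ?_, ?_⟩
    · rw [hout c (by lia), h.outside c hc]
    · rw [show min (i + 1) n = min i n by lia]
      exact h.left.congr fun c _ h₂ => hout c (by lia)
    · rwa [show i + 1 - n = i - n + 1 by lia]

theorem reach_counts (hp : Params σ n k W X D) (hE : Env n k X D reg₀)
    (hw : ∀ i < n + n, mem₀ i = w i) (hwσ : ∀ i < n + n, w i < σ) (hx : ∀ a j, x a j < X)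
    (htab : ∀ i < n + n, ∀ j < k,
      mem₀ (n + n + (k * k + k) + (k * k + k) + w i * k + j) = x (w i) j)
    (hB₁ : Block k D mem₀ (n + n) (weightedCount x w 0))
    (hB₂ : Block k D mem₀ (n + n + (k * k + k)) (weightedCount x (fun a => w (n + a)) 0)) :
    Reach binomTest ω ((n + n) * (k * (k * 12 + 11) + 13) + 2)
      (At 64 u fun reg mem => Env n k X D reg ∧
        Block k D mem (n + n) (weightedCount x w n) ∧
        Block k D mem (n + n + (k * k + k)) (weightedCount x (fun a => w (n + a)) n))
      ⟨29, reg₀, mem₀, u, none⟩ := by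
  refine Reach.const rfl (by have := hp.one_lt; lia) ?_
  refine (Reach.loop_at (v := fun _ => u) (I := CountsInv n k X D x w mem₀)
    (fun i hi reg mem h => h.step hp hw hwσ hx htab hi) ?_).trans_at ?_
  · refine ⟨hE.congr (r := 11) ?_ le_rfl, by simp, fun _ _ => rfl, ?_, ?_⟩
    · simp [eqOn_Iio_update_iff, Set.eqOn_refl]
    · simpa using hB₁
    · simpa using hB₂
  · intro reg mem h
    have hB₁ := h.left
    have hB₂ := h.right
    rw [min_eq_right (by lia)] at hB₁
    rw [Nat.add_sub_cancel] at hB₂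
    exact Reach.jumpEq_pos rfl (by rw [h.r12, h.env.r7]) (Reach.at_refl ⟨h.env, hB₁, hB₂⟩)

end Counts

section Compare

variable {σ n k W X D p q d u : ℕ} {ω : ℕ → Fin (2 ^ W)} {reg mem g₁ g₂ : ℕ → ℕ}

theorem reach_compareCells (hp : p + d < 2 ^ W) (hq : q + d < 2 ^ W) (h3 : reg 3 = 1)
    (h9 : reg 9 = p + d) (h20 : reg 20 = p) (h21 : reg 21 = q) :
    Reach binomTest ω (d * 7 + 2)
      (fun s => s.answer = some (decide (∀ c < d, mem (p + c) = mem (q + c))))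
      ⟨66, reg, mem, u, none⟩ := by
  induction d generalizing p q reg with
  | zero =>
    exact Reach.jumpEq_pos rfl (by rw [h20, h9, add_zero]) (by simpa using Reach.halt rfl)
  | succ d ih =>
    have hall : (∀ c < d + 1, mem (p + c) = mem (q + c)) ↔
        mem p = mem q ∧ ∀ c < d, mem (p + 1 + c) = mem (q + 1 + c) := by
      simp only [Nat.forall_lt_succ_left', add_zero, add_assoc, add_comm 1]
    rw [show (d + 1) * 7 + 2 = d * 7 + 2 + 7 by ring]
    refine Reach.jumpEq_neg rfl (by rw [h20, h9]; lia) ?_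
    refine Reach.load (x := mem p) rfl (by rw [h20]) ?_
    refine Reach.load (x := mem q) rfl (by simp [h21]) ?_
    by_cases h : mem p = mem q
    · refine Reach.jumpEq_pos rfl (by simp [h]) ?_
      refine Reach.add (z := p + 1) rfl (by simp [h20, h3]) (by lia) ?_
      refine Reach.add (z := q + 1) rfl (by simp [h21, h3]) (by lia) ?_
      refine Reach.jump rfl ?_
      simp only [hall, h, true_and]
      refine ih (by lia) (by lia) ?_ ?_ ?_ ?_
      · simp [h3]
      · simp [h9, add_assoc, add_comm 1]
      · simp
      · simp
    · refine Reach.jumpEq_neg rfl (by simp [h]) ?_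
      rw [decide_eq_false (fun hc => h (hall.1 hc).1)]
      exact Reach.halt rfl

theorem reach_compare (hp : Params σ n k W X D) (hE : Env n k X D reg)
    (hB₁ : Block k D mem (n + n) g₁) (hB₂ : Block k D mem (n + n + (k * k + k)) g₂)
    (hg₁ : ∀ j ≤ k, g₁ j < D ^ k) (hg₂ : ∀ j ≤ k, g₂ j < D ^ k) :
    Reach binomTest ω ((k * k + k) * 7 + 4)
      (fun s => s.answer = some (decide (∀ j ≤ k, g₁ j = g₂ j)))
      ⟨64, reg, mem, u, none⟩ := by
  have haddr := hp.addr_lt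
  simp only [hB₁.forall_eq_iff hB₂ hp.k_pos hg₁ hg₂]
  refine Reach.copy rfl hE.r7 ?_
  refine Reach.copy (x := n + n + (k * k + k)) rfl (by simp [hE.r9]) ?_
  refine reach_compareCells (by lia) (by lia) ?_ ?_ ?_ ?_
  · simp [hE.r3]
  · simp [hE.r9]
  · simp
  · simp

end Compare

section Init

variable {σ n k W : ℕ} {ω : ℕ → Fin (2 ^ W)} {mem₀ reg mem : ℕ → ℕ}

theorem params_of_le {B N : ℕ} (hk : 0 < k) (hkn : k ≤ n) (hN : n + σ + 2 ≤ N) (hnB : n < B)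
    (hBN : B ≤ N) (hNW : N ^ 8 ≤ 2 ^ W) : Params σ n k W (B * B) (B * B * B) := by
  have hX : B * B ≤ N ^ 2 := by simpa [pow_two] using Nat.mul_le_mul hBN hBN
  have hD : B * B * B ≤ N ^ 3 := by simpa [pow_succ] using Nat.mul_le_mul hX hBN
  have h8 : 8 * N ^ 5 ≤ N ^ 8 := by
    calc 8 * N ^ 5 = 2 ^ 3 * N ^ 5 := by norm_num
      _ ≤ N ^ 3 * N ^ 5 := Nat.mul_le_mul_right _ (Nat.pow_le_pow_left (by lia) 3)
      _ = N ^ 8 := by ring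
  have h2 : N ^ 2 ≤ N ^ 5 := Nat.pow_le_pow_right (by lia) (by norm_num)
  have h3 : N ^ 3 ≤ N ^ 5 := Nat.pow_le_pow_right (by lia) (by norm_num)
  have hB : 0 < B * B := Nat.mul_pos (by lia) (by lia)
  refine ⟨hk, hkn, hB, Nat.mul_pos hB (by lia), by lia, ?_, ?_, ?_⟩
  · rw [mul_comm]
    exact Nat.mul_lt_mul_of_pos_left hnB hB
  · have hDX : B * B * B * (B * B) ≤ N ^ 5 := by
      calc B * B * B * (B * B) ≤ N ^ 3 * N ^ 2 := Nat.mul_le_mul hD hX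
        _ = N ^ 5 := by ring
    lia
  · have hmul {a b : ℕ} (ha : a ≤ N) (hb : b ≤ N) : a * b ≤ N ^ 2 := by
      simpa [pow_two] using Nat.mul_le_mul ha hb
    have hkk : k * k ≤ N ^ 2 := hmul (by lia) (by lia)
    have hσk : σ * k ≤ N ^ 2 := hmul (by lia) (by lia)
    have h2N : 2 * N ≤ N ^ 2 := hmul (by lia) le_rfl
    lia

theorem params_of_clog_le (hk : 0 < k) (hkn : k ≤ n) (hW : 8 * Nat.clog 2 (n + σ + 2) ≤ W) :
    Params σ n k W (2 ^ n.size * 2 ^ n.size) (2 ^ n.size * 2 ^ n.size * 2 ^ n.size) := by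
  have hN : n + σ + 2 ≤ 2 ^ Nat.clog 2 (n + σ + 2) := Nat.le_pow_clog (by norm_num) _
  refine params_of_le hk hkn hN (Nat.lt_size_self n) ?_ ?_
  · exact Nat.pow_le_pow_right (by norm_num) (Nat.size_le.2 (by lia))
  · rw [← pow_mul, mul_comm]
    exact Nat.pow_le_pow_right (by norm_num) hW

/-- The loop invariant of the search for the least power of two greater than `n`, after `i`
doublings. -/
structure DoublingInv (n k : ℕ) (mem₀ : ℕ → ℕ) (i : ℕ) (reg mem : ℕ → ℕ) : Prop where
  r0 : reg 0 = n
  r1 : reg 1 = k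
  r3 : reg 3 = 1
  r4 : reg 4 = 2 ^ i
  r12 : reg 12 = 0
  mem_eq : mem = mem₀

theorem DoublingInv.step {i : ℕ} (hi : i < n.size) (hlt : 2 ^ n.size < 2 ^ W)
    (h : DoublingInv n k mem₀ i reg mem) :
    Reach binomTest ω 3 (At 4 0 (DoublingInv n k mem₀ (i + 1))) ⟨4, reg, mem, 0, none⟩ := by
  refine Reach.jumpLt_neg rfl (by rw [h.r0, h.r4]; exact (Nat.lt_size.1 hi).not_gt) ?_
  refine Reach.add (z := 2 ^ (i + 1)) rfl (by rw [h.r4, pow_succ, mul_two])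
    ((Nat.pow_le_pow_right (by norm_num) hi).trans_lt hlt) ?_
  refine Reach.jump rfl (Reach.at_refl ⟨?_, ?_, ?_, ?_, ?_, h.mem_eq⟩) <;>
    simp [h.r0, h.r1, h.r3, h.r12]

theorem reach_doubling (w₁ w₂ : Fin n → Fin σ) (hk : 0 < k) (hlt : 2 ^ n.size < 2 ^ W) :
    Reach binomTest ω (n.size * 3 + 4) (At 7 0 (DoublingInv n k (start k w₁ w₂).mem n.size))
      (start k w₁ w₂) := by
  have hone : 1 < 2 ^ W := (Nat.one_le_two_pow).trans_lt hlt
  refine Reach.const rfl hone ?_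
  refine Reach.jumpLt_pos rfl (by simpa using hk) ?_
  refine Reach.const rfl hone ?_
  refine (Reach.loop_at (v := fun _ => 0) (I := DoublingInv n k (start k w₁ w₂).mem)
    (fun i hi reg mem h => h.step hi hlt) ?_).trans_at ?_
  · refine ⟨?_, ?_, ?_, ?_, ?_, rfl⟩ <;> simp
  · intro reg mem h
    refine Reach.jumpLt_pos rfl ?_ (Reach.at_refl h)
    rw [h.r0, h.r4]
    exact Nat.lt_size_self n

theorem reach_init (w₁ w₂ : Fin n → Fin σ)
    (hp : Params σ n k W (2 ^ n.size * 2 ^ n.size) (2 ^ n.size * 2 ^ n.size * 2 ^ n.size)) :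
    Reach binomTest ω (n * 3 + 13)
      (At 16 0 fun reg mem =>
        Env n k (2 ^ n.size * 2 ^ n.size) (2 ^ n.size * 2 ^ n.size * 2 ^ n.size) reg ∧
        reg 12 = 0 ∧ mem = Function.update (Function.update (start k w₁ w₂).mem (n + n) 1)
          (n + n + (k * k + k)) 1)
      (start k w₁ w₂) := by
  have haddr := hp.addr_lt
  have hdigit := hp.digit_lt
  have hBX : 2 ^ n.size ≤ 2 ^ n.size * 2 ^ n.size := Nat.le_mul_self _
  have hsize : n.size ≤ n := Nat.size_le.2 Nat.lt_two_pow_self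
  refine ((reach_doubling w₁ w₂ hp.k_pos (by lia)).trans_at (T' := 9)
    fun reg mem h => ?_).mono (by lia)
  refine Reach.mul (z := 2 ^ n.size * 2 ^ n.size) rfl (by rw [h.r4]) (by lia) ?_
  refine Reach.mul (z := 2 ^ n.size * 2 ^ n.size * 2 ^ n.size) rfl (by simp [h.r4]) (by lia) ?_
  refine Reach.add (z := n + n) rfl (by simp [h.r0]) (by lia) ?_
  refine Reach.mul (z := k * k) rfl (by simp [h.r1]) (by lia) ?_
  refine Reach.add (z := k * k + k) rfl (by simp [h.r1]) (by lia) ?_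
  refine Reach.add (z := n + n + (k * k + k)) rfl (by simp) (by lia) ?_
  refine Reach.add (z := n + n + (k * k + k) + (k * k + k)) rfl (by simp) (by lia) ?_
  refine Reach.store (x := n + n) (y := 1) rfl (by simp) (by simp [h.r3]) ?_
  refine Reach.store (x := n + n + (k * k + k)) (y := 1) rfl (by simp) (by simp [h.r3]) ?_
  refine Reach.at_refl ⟨?_, ?_, by rw [h.mem_eq]⟩
  · constructor <;> simp [h.r0, h.r1, h.r3]
  · simp [h.r12]

end Init

section Answer

variable {σ n k W T : ℕ} {w₁ w₂ : Fin n → Fin σ}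

theorem start_mem_lt {i : ℕ} (hi : i < n + n) : (start k w₁ w₂).mem i < σ := by
  simp only [start]
  split_ifs with h₁ h₂
  · exact (w₁ _).2
  · exact (w₂ _).2
  · lia

theorem start_mem_of_le {i : ℕ} (hi : n + n ≤ i) : (start k w₁ w₂).mem i = 0 := by
  simp only [start]
  rw [dif_neg (by lia), dif_neg (by lia)]

theorem start_mem_left (i : Fin n) : (start k w₁ w₂).mem i = w₁ i := by
  simp [start]

theorem start_mem_right (i : Fin n) : (start k w₁ w₂).mem (n + i) = w₂ i := by
  simp [start]

theorem Params.weightedCount_lt {X D : ℕ} {x : ℕ → ℕ → ℕ} {w : ℕ → ℕ} (hp : Params σ n k W X D)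
    (hx : ∀ a j, x a j < X) {j : ℕ} (hj : j ≤ k) : weightedCount x w n j < D ^ k := by
  have hn : 0 < n := hp.k_pos.trans_le hp.k_le
  calc weightedCount x w n j ≤ n.choose j * X ^ j := weightedCount_le fun _ _ _ _ => (hx _ _).le
    _ ≤ n ^ j * X ^ j := Nat.mul_le_mul_right _ (Nat.choose_le_pow n j)
    _ = (n * X) ^ j := (mul_pow _ _ _).symm
    _ ≤ (n * X) ^ k := Nat.pow_le_pow_right (Nat.mul_pos hn hp.X_pos) hj
    _ < D ^ k := Nat.pow_lt_pow_left hp.mul_lt hp.k_pos.ne'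

theorem Params.reach_answer {X D : ℕ} (hp : Params σ n k W X D) (ω : ℕ → Fin (2 ^ W))
    {w reg mem : ℕ → ℕ} (hE : Env n k X D reg) (h12 : reg 12 = 0) (hw : ∀ i < n + n, w i < σ)
    (hwmem : ∀ i < n + n, mem i = w i) (h₁ : mem (n + n) = 1)
    (h₂ : mem (n + n + (k * k + k)) = 1)
    (h₀ : ∀ c, n + n < c → c ≠ n + n + (k * k + k) → mem c = 0) :
    Reach binomTest ω (((n + n) * (k * 6 + 8) + 1) +
        (((n + n) * (k * (k * 12 + 11) + 13) + 2) + ((k * k + k) * 7 + 4)))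
      (fun s => s.answer = some (decide (∀ j ≤ k, weightedCount (weight ω k X w (n + n)) w n j =
        weightedCount (weight ω k X w (n + n)) (fun a => w (n + a)) n j)))
      ⟨16, reg, mem, 0, none⟩ := by
  have hkpos := hp.k_pos
  have hlt : ∀ a j, weight ω k X w (n + n) a j < X := weight_lt hp.X_pos (n + n)
  have hD : 1 < D := lt_of_le_of_lt (Nat.mul_pos (hkpos.trans_le hp.k_le) hp.X_pos) hp.mul_lt
  refine (reach_weights hp hE h12 hwmem hw).trans_at fun reg' mem' h => ?_
  refine (reach_counts hp h.env (w := w) ?_ hw hlt h.table ?_ ?_).trans_at ?_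
  · intro i hi
    rw [h.low i (by lia), hwmem i hi]
  · refine block_weightedCount_zero hD ?_ fun c hc hc' => ?_
    · rw [h.low _ (by lia), h₁]
    · rw [h.low c (by lia), h₀ c hc (by lia)]
  · refine block_weightedCount_zero hD ?_ fun c hc hc' => ?_
    · rw [h.low _ (by lia), h₂]
    · rw [h.low c (by lia), h₀ c (by lia) (by lia)]
  · rintro reg mem ⟨hE, hB₁, hB₂⟩
    exact reach_compare hp hE hB₁ hB₂ (fun j hj => hp.weightedCount_lt hlt hj)
      fun j hj => hp.weightedCount_lt hlt hj

theorem steps_le (hk : 0 < k) (hkn : k ≤ n) :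
    (n * 3 + 13) + (((n + n) * (k * 6 + 8) + 1) +
      (((n + n) * (k * (k * 12 + 11) + 13) + 2) + ((k * k + k) * 7 + 4))) ≤
        200 * (n * k ^ 2 + 1) := by
  nlinarith [Nat.mul_le_mul_left n hk, Nat.mul_le_mul_left (n * k) hk, Nat.mul_le_mul_right k hkn]

theorem one_lt_two_pow_of_clog_le (hW : 8 * Nat.clog 2 (n + σ + 2) ≤ W) : 1 < 2 ^ W := by
  have hpos : 0 < Nat.clog 2 (n + σ + 2) := Nat.clog_pos (by norm_num) (by lia)
  exact Nat.one_lt_two_pow (by lia)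

theorem answerWithin_binomTest (w₁ w₂ : Fin n → Fin σ) (ω : ℕ → Fin (2 ^ W)) (hkn : k ≤ n)
    (hW : 8 * Nat.clog 2 (n + σ + 2) ≤ W) (hT : 200 * (n * k ^ 2 + 1) ≤ T) {w : ℕ → ℕ}
    (hw : w = (start k w₁ w₂).mem) {x : ℕ → ℕ → ℕ}
    (hx : x = weight ω k (2 ^ n.size * 2 ^ n.size) w (n + n)) :
    answerWithin binomTest ω (start k w₁ w₂) T = some (decide (∀ j ≤ k,
      weightedCount x w n j = weightedCount x (fun a => w (n + a)) n j)) := by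
  subst hw hx
  apply answerWithin_of_reach
  rcases Nat.eq_zero_or_pos k with rfl | hk
  · rw [decide_eq_true (by simp)]
    refine Reach.mono (T := 3) ?_ (by lia)
    refine Reach.const rfl (one_lt_two_pow_of_clog_le hW) ?_
    exact Reach.jumpLt_neg rfl (by simp) (Reach.halt rfl)
  · have hp := params_of_clog_le hk hkn hW
    refine ((reach_init w₁ w₂ hp).trans_at ?_).mono ((steps_le hk hkn).trans hT)
    rintro reg mem ⟨hE, h12, rfl⟩
    refine hp.reach_answer ω hE h12 (fun i hi => start_mem_lt hi) ?_ ?_ ?_ ?_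
    · intro i hi
      rw [Function.update_of_ne (by lia), Function.update_of_ne (by lia)]
    · rw [Function.update_of_ne (by lia), Function.update_self]
    · rw [Function.update_self]
    · intro c hc hc'
      rw [Function.update_of_ne hc', Function.update_of_ne (by lia), start_mem_of_le (by lia)]

end Answer

/-! ### The probability of error -/

section SchwartzZippel

open Finset

theorem card_filter_comp_mem_le {ι α β : Type*} [Fintype ι] [DecidableEq ι] [Fintype α]
    [DecidableEq β] {g : α → β} {c : ℕ} (hc : ∀ b, #{a | g a = b} ≤ c) (Z : Finset (ι → β)) :
    #{u : ι → α | g ∘ u ∈ Z} ≤ c ^ Fintype.card ι * #Z := by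
  refine card_le_mul_card_image_of_maps_to (f := fun u : ι → α => g ∘ u)
    (fun u hu => (mem_filter.1 hu).2) _ fun f _ => ?_
  calc #{u ∈ ({u | g ∘ u ∈ Z} : Finset (ι → α)) | g ∘ u = f}
      ≤ #(Fintype.piFinset fun i => ({a | g a = f i} : Finset α)) := by
        refine card_le_card fun u hu => Fintype.mem_piFinset.2 fun i => ?_
        simpa using congrFun (mem_filter.1 hu).2 i
    _ ≤ c ^ Fintype.card ι := by
        rw [Fintype.card_piFinset]
        exact prod_le_pow_card _ _ _ fun i _ => hc (f i)

theorem card_filter_mod_eq_le (X c b : ℕ) : #{a : Fin (X * c) | (a : ℕ) % X = b} ≤ c := by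
  conv_rhs => rw [← card_range c]
  refine card_le_card_of_injOn (fun a => (a : ℕ) / X) (fun a _ => ?_) fun a ha a' ha' haa' => ?_
  · exact mem_coe.2 (mem_range.2 (Nat.div_lt_of_lt_mul a.isLt))
  · have hmod : (a : ℕ) % X = a' % X := (mem_filter.1 ha).2.trans (mem_filter.1 ha').2.symm
    have hdiv : (a : ℕ) / X = a' / X := haa'
    ext
    rw [← Nat.div_add_mod (a : ℕ) X, ← Nat.div_add_mod (a' : ℕ) X, hdiv, hmod]

theorem card_eval_natCast_eq_zero_le {T : ℕ} {p : MvPolynomial (Fin T) ℤ} (hp : p ≠ 0) {X : ℕ}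
    (hX : 0 < X) :
    (#{f ∈ Fintype.piFinset fun _ : Fin T => range X |
        MvPolynomial.eval (fun i => (f i : ℤ)) p = 0} : ℝ) ≤ p.totalDegree / X * (X : ℝ) ^ T := by
  have hsz := (NNRat.cast_le (K := ℝ)).2
    (MvPolynomial.schwartz_zippel_totalDegree hp ((range X).map Nat.castEmbedding))
  push_cast [card_map, card_range] at hsz
  rw [div_le_iff₀ (by positivity)] at hsz
  refine le_trans (Nat.cast_le.2 (card_le_card_of_injOn (fun f i => (f i : ℤ)) ?_ ?_)) hsz
  · intro f hf
    obtain ⟨hf, hzero⟩ := mem_filter.1 hf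
    exact mem_coe.2 (mem_filter.2 ⟨Fintype.mem_piFinset.2 fun i =>
      mem_map_of_mem _ (Fintype.mem_piFinset.1 hf i), hzero⟩)
  · intro f _ f' _ h
    funext i
    exact Nat.cast_injective (congrFun h i)

theorem card_eval_mod_eq_zero_le {T W X : ℕ} (hX : X ∣ 2 ^ W) {p : MvPolynomial (Fin T) ℤ}
    (hp : p ≠ 0) :
    (#{u : Fin T → Fin (2 ^ W) | MvPolynomial.eval (fun i => ((u i % X : ℕ) : ℤ)) p = 0} : ℝ) ≤
      p.totalDegree / X * (2 ^ W : ℝ) ^ T := by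
  have hpos : 0 < X := Nat.pos_of_dvd_of_pos hX (by positivity)
  obtain ⟨c, hc⟩ := hX
  set Z := {f ∈ Fintype.piFinset fun _ : Fin T => range X |
    MvPolynomial.eval (fun i => (f i : ℤ)) p = 0} with hZ
  have hfibre : #{u : Fin T → Fin (2 ^ W) | (fun a : Fin (2 ^ W) => (a : ℕ) % X) ∘ u ∈ Z} ≤
      c ^ T * #Z := by
    simpa using card_filter_comp_mem_le (ι := Fin T) (hc ▸ card_filter_mod_eq_le X c) Z
  calc _ ≤ ((c ^ T * #Z : ℕ) : ℝ) := by
        refine Nat.cast_le.2 (le_trans (card_le_card fun u hu => ?_) hfibre)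
        simpa [hZ, Nat.mod_lt _ hpos] using hu
    _ = (c : ℝ) ^ T * #Z := by push_cast; rfl
    _ ≤ (c : ℝ) ^ T * (p.totalDegree / X * (X : ℝ) ^ T) := by
        gcongr
        exact card_eval_natCast_eq_zero_le hp hpos
    _ = p.totalDegree / X * ((X * c : ℕ) : ℝ) ^ T := by push_cast; ring
    _ = p.totalDegree / X * (2 ^ W : ℝ) ^ T := by rw [← hc]; push_cast; rfl

end SchwartzZippel

section Error

variable {σ n k m T W X : ℕ} {w : ℕ → ℕ} {w₁ w₂ : Fin n → Fin σ}

/-- The random word that determines the weight of the letter `a` in the `j`-th row. The reduction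
modulo `T` is without effect for the letters of the input. -/
def weightIndex (hT : 0 < T) (k N : ℕ) (w : ℕ → ℕ) (a j : ℕ) : Fin T :=
  ⟨(lastPos w N a * k + j) % T, Nat.mod_lt _ hT⟩

theorem val_weightIndex (hT : 0 < T) {N : ℕ} (hNT : N * k ≤ T) {i j : ℕ} (hi : i < N)
    (hj : j < k) : (weightIndex hT k N w (w i) j : ℕ) = lastPos w N (w i) * k + j := by
  have hrow : (lastPos w N (w i) + 1) * k ≤ N * k := Nat.mul_le_mul_right k (lastPos_spec hi).1
  exact Nat.mod_eq_of_lt (by lia)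

theorem injOn_weightIndex (hT : 0 < T) {N : ℕ} (hNT : N * k ≤ T) (hmk : m ≤ k) :
    Set.InjOn (Function.uncurry (weightIndex hT k N w)) ((w '' Set.Iio N) ×ˢ Set.Iio m) := by
  rintro ⟨_, j⟩ ⟨⟨i, hi, rfl⟩, hj⟩ ⟨_, j'⟩ ⟨⟨i', hi', rfl⟩, hj'⟩ h
  have hjk : j < k := lt_of_lt_of_le hj hmk
  have hjk' : j' < k := lt_of_lt_of_le hj' hmk
  have hval : lastPos w N (w i) * k + j = lastPos w N (w i') * k + j' := by
    rw [← val_weightIndex hT hNT hi hjk, ← val_weightIndex hT hNT hi' hjk']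
    exact congrArg Fin.val h
  have hpos : lastPos w N (w i) = lastPos w N (w i') := by
    simpa [Nat.mul_add_div (Nat.zero_lt_of_lt hjk), Nat.div_eq_of_lt, hjk, hjk', mul_comm _ k]
      using congrArg (· / k) hval
  rw [hpos, Nat.add_left_cancel_iff] at hval
  have hletter : w i = w i' := by
    rw [← (lastPos_spec (w := w) hi).2, hpos, (lastPos_spec (w := w) hi').2]
  rw [hletter, hval]

theorem weight_extend (hT : 0 < T) {N : ℕ} (hNT : N * k ≤ T) (u : Fin T → Fin (2 ^ W)) {i j : ℕ}
    (hi : i < N) (hj : j < k) :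
    weight (extend u) k X w N (w i) j = (u (weightIndex hT k N w (w i) j) : ℕ) % X := by
  have hval := val_weightIndex (w := w) hT hNT hi hj
  have hlt : lastPos w N (w i) * k + j < T := hval ▸ Fin.isLt _
  rw [weight, extend, dif_pos hlt]
  simp only [← hval, Fin.eta]

theorem eval_weightedCount_X (hT : 0 < T) {N : ℕ} (hNT : N * k ≤ T) (hmk : m ≤ k)
    (u : Fin T → Fin (2 ^ W)) {s : ℕ} (hs : s + n ≤ N) :
    MvPolynomial.eval (fun i => ((u i % X : ℕ) : ℤ)) (weightedCount
      (fun a j => MvPolynomial.X (weightIndex hT k N w a j)) (fun a => w (s + a)) n m) =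
        ((weightedCount (weight (extend u) k X w N) (fun a => w (s + a)) n m : ℕ) : ℤ) := by
  have hcast := map_weightedCount (Nat.castRingHom ℤ) (weight (extend u) k X w N)
    (fun a => w (s + a)) n m
  rw [eq_natCast] at hcast
  rw [map_weightedCount, hcast]
  refine weightedCount_congr fun a ha b hb => ?_
  rw [MvPolynomial.eval_X, weight_extend hT hNT u (by lia) (hb.trans_le hmk), eq_natCast]

open Finset in
theorem card_weightedCount_eq_le (hw₁ : ∀ a : Fin n, w a = w₁ a)
    (hw₂ : ∀ a : Fin n, w (n + a) = w₂ a) (hX : X ∣ 2 ^ W) (hmk : m ≤ k) (hT : 0 < T)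
    (hnT : (n + n) * k ≤ T) {v : Fin m → Fin σ} (hv : binom w₁ v ≠ binom w₂ v) :
    (#{u : Fin T → Fin (2 ^ W) | weightedCount (weight (extend u) k X w (n + n)) w n m =
      weightedCount (weight (extend u) k X w (n + n)) (fun a => w (n + a)) n m} : ℝ) ≤
      m / X * (2 ^ W : ℝ) ^ T := by
  let x (a j : ℕ) : MvPolynomial (Fin T) ℤ := MvPolynomial.X (weightIndex hT k (n + n) w a j)
  let p := weightedCount x w n m - weightedCount x (fun a => w (n + a)) n m
  have hp : p ≠ 0 := sub_ne_zero.2 <| weightedCount_X_ne (L := w '' Set.Iio (n + n)) hw₁ hw₂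
    (fun a ha => ⟨a, Set.mem_Iio.2 (by lia), rfl⟩)
    (fun a ha => ⟨n + a, Set.mem_Iio.2 (by lia), rfl⟩) (injOn_weightIndex hT hnT hmk) hv
  have hdeg : p.totalDegree ≤ m :=
    have hx : ∀ a j, (x a j).totalDegree ≤ 1 := fun a j => (MvPolynomial.totalDegree_X _).le
    (MvPolynomial.totalDegree_sub _ _).trans
      (max_le (totalDegree_weightedCount_le hx _ _ _) (totalDegree_weightedCount_le hx _ _ _))
  refine le_trans ?_ ((card_eval_mod_eq_zero_le hX hp).trans (by gcongr))
  refine Nat.cast_le.2 (card_le_card fun u hu => mem_filter.2 ⟨mem_univ _, ?_⟩)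
  have hleft := eval_weightedCount_X (w := w) (X := X) hT hnT hmk u (by lia : 0 + n ≤ n + n)
  have hright := eval_weightedCount_X (w := w) (X := X) hT hnT hmk u le_rfl
  simp only [zero_add] at hleft
  rw [map_sub, hleft, hright, (mem_filter.1 hu).2, sub_self]

open Finset in
theorem one_sub_le_probAnswer_of_card_le {P : Program} {s : Config} {r : Bool} {ε : ℝ}
    {B : Finset (Fin T → Fin (2 ^ W))}
    (hB : ∀ u ∉ B, answerWithin P (extend u) s T = some r) (hcard : (#B : ℝ) ≤ ε * (2 ^ W) ^ T) :
    1 - ε ≤ probAnswer P W s T r := by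
  have htotal : (Fintype.card (Fin T → Fin (2 ^ W)) : ℝ) = (2 ^ W) ^ T := by simp
  have hcover : (univ : Finset (Fin T → Fin (2 ^ W))) ⊆
      ({u | answerWithin P (extend u) s T = some r} : Finset _) ∪ B := fun u _ => by
    by_cases hu : u ∈ B
    · exact mem_union_right _ hu
    · exact mem_union_left _ (mem_filter.2 ⟨mem_univ _, hB u hu⟩)
  have hunion : (Fintype.card (Fin T → Fin (2 ^ W)) : ℝ) ≤
      #{u : Fin T → Fin (2 ^ W) | answerWithin P (extend u) s T = some r} + #B := by
    exact_mod_cast (card_le_card hcover).trans (card_union_le _ _)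
  rw [probAnswer, htotal, le_div_iff₀ (by positivity)]
  linarith

theorem div_size_sq_le (hmn : m ≤ n) (hn : 0 < n) :
    (m : ℝ) / (2 ^ n.size * 2 ^ n.size : ℕ) ≤ 1 / n := by
  have hle : m * n ≤ 2 ^ n.size * 2 ^ n.size :=
    Nat.mul_le_mul (hmn.trans (Nat.lt_size_self n).le) (Nat.lt_size_self n).le
  rw [div_le_div_iff₀ (by positivity) (by positivity), one_mul]
  exact_mod_cast hle

theorem size_sq_dvd_of_clog_le (hW : 8 * Nat.clog 2 (n + σ + 2) ≤ W) :
    2 ^ n.size * 2 ^ n.size ∣ 2 ^ W := by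
  have hsize : n.size ≤ Nat.clog 2 (n + σ + 2) :=
    Nat.size_le.2 (lt_of_lt_of_le (by lia) (Nat.le_pow_clog (by norm_num) _))
  rw [← pow_add]
  exact pow_dvd_pow 2 (by lia)

theorem one_sub_inv_le_probAnswer (hkn : k ≤ n) (hW : 8 * Nat.clog 2 (n + σ + 2) ≤ W)
    (hT : 200 * (n * k ^ 2 + 1) ≤ T) (h : ¬ BinomEquiv k w₁ w₂) :
    1 - 1 / (n : ℝ) ≤ probAnswer binomTest W (start k w₁ w₂) T false := by
  classical
  obtain ⟨m, hmk, v, hv⟩ : ∃ m ≤ k, ∃ v : Fin m → Fin σ, binom w₁ v ≠ binom w₂ v := by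
    simpa [BinomEquiv] using h
  have hm : 0 < m := Nat.pos_of_ne_zero fun hm => by subst hm; simp at hv
  have hnT : (n + n) * k ≤ T := by
    have hk : n * k ≤ n * k ^ 2 := Nat.mul_le_mul_left _ (Nat.le_self_pow (by norm_num) k)
    lia
  have hbad := card_weightedCount_eq_le (start_mem_left (k := k)) start_mem_right
    (size_sq_dvd_of_clog_le hW) hmk (by lia) hnT hv
  refine one_sub_le_probAnswer_of_card_le (fun u hu => ?_) (hbad.trans ?_)
  · rw [answerWithin_binomTest w₁ w₂ _ hkn hW hT rfl rfl, decide_eq_false]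
    exact fun hall => hu (Finset.mem_filter.2 ⟨Finset.mem_univ _, hall m hmk⟩)
  · exact mul_le_mul_of_nonneg_right (div_size_sq_le (hmk.trans hkn) (by lia)) (by positivity)

end Error

end WordRAM

theorem theorem2_general :
    (∃ (P : WordRAM.Program) (c C : ℕ), 1 ≤ c ∧
      ∀ (σ n k W T : ℕ) (w₁ w₂ : Fin n → Fin σ), k ≤ n → c * Nat.clog 2 (n + σ + 2) ≤ W →
        C * (n * k ^ 2 + 1) ≤ T →
        (∀ ω : ℕ → Fin (2 ^ W), ∃ r : Bool,
          WordRAM.answerWithin P ω (WordRAM.start k w₁ w₂) T = some r) ∧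
        (KBinomial.BinomEquiv k w₁ w₂ → ∀ ω : ℕ → Fin (2 ^ W),
          WordRAM.answerWithin P ω (WordRAM.start k w₁ w₂) T = some true) ∧
        (¬ KBinomial.BinomEquiv k w₁ w₂ →
          1 - 1 / (n : ℝ) ≤ WordRAM.probAnswer P W (WordRAM.start k w₁ w₂) T false)) ∧
    (∀ (n k : ℕ) (w₁ w₂ : Fin n → Fin 2),
      (KBinomial.BinomEquiv k w₁ w₂ →
        ∀ p ∈ KBinomial.bitPrimes (KBinomial.primeBits n k), ∀ x : ZMod p,
          Polynomial.aeval x (KBinomial.Q k w₁) = Polynomial.aeval x (KBinomial.Q k w₂)) ∧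
      (¬ KBinomial.BinomEquiv k w₁ w₂ →
        1 - 1 / (n : ℝ) ≤ KBinomial.fingerprintNoProb k w₁ w₂)) := by
  refine ⟨⟨WordRAM.binomTest, 8, 200, by norm_num, fun σ n k W T w₁ w₂ hkn hW hT => ?_⟩,
    fun n k w₁ w₂ => ⟨fun h p _ x => by rw [h.Q_eq],
      KBinomial.one_sub_inv_le_fingerprintNoProb⟩⟩
  have hans (ω : ℕ → Fin (2 ^ W)) :=
    WordRAM.answerWithin_binomTest w₁ w₂ ω hkn hW hT rfl rfl
  refine ⟨fun ω => ⟨_, hans ω⟩, fun h ω => ?_, WordRAM.one_sub_inv_le_probAnswer hkn hW hT⟩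
  rw [hans, decide_eq_true]
  exact fun j hj => h.weightedCount_eq WordRAM.start_mem_left WordRAM.start_mem_right _ hj

theorem theorem2 :
    -- a Monte-Carlo program for the unit-cost RAM with words of `Ω(log n)` bits
    (∃ (P : WordRAM.Program) (c C : ℕ), 1 ≤ c ∧
      ∀ (σ n k W : ℕ) (w₁ w₂ : Fin n → Fin σ), k ≤ n → c * Nat.clog 2 (n + σ + 2) ≤ W →
        (∀ ω : ℕ → Fin (2 ^ W), ∃ r : Bool,
          WordRAM.answerWithin P ω (WordRAM.start k w₁ w₂)
            (C * (n * k ^ 2 + k ^ 4 + 1)) = some r) ∧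
        (KBinomial.BinomEquiv k w₁ w₂ → ∀ ω : ℕ → Fin (2 ^ W),
          WordRAM.answerWithin P ω (WordRAM.start k w₁ w₂)
            (C * (n * k ^ 2 + k ^ 4 + 1)) = some true) ∧
        (¬ KBinomial.BinomEquiv k w₁ w₂ →
          1 - 1 / (n : ℝ) ≤
            WordRAM.probAnswer P W (WordRAM.start k w₁ w₂)
              (C * (n * k ^ 2 + k ^ 4 + 1)) false)) ∧
    -- the fingerprint test for binary words
    (∀ (n k : ℕ) (w₁ w₂ : Fin n → Fin 2), k ≤ n →
      (KBinomial.BinomEquiv k w₁ w₂ →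
        ∀ p ∈ KBinomial.bitPrimes (KBinomial.primeBits n k), ∀ x : ZMod p,
          Polynomial.aeval x (KBinomial.Q k w₁) = Polynomial.aeval x (KBinomial.Q k w₂)) ∧
      (¬ KBinomial.BinomEquiv k w₁ w₂ →
        1 - 1 / (n : ℝ) ≤ KBinomial.fingerprintNoProb k w₁ w₂)) :=
  let ⟨⟨P, c, C, hc, hP⟩, hQ⟩ := theorem2_general
  ⟨⟨P, c, C, hc, fun σ n k W w₁ w₂ hkn hW =>
    hP σ n k W _ w₁ w₂ hkn hW (Nat.mul_le_mul_left C (by lia))⟩, fun n k w₁ w₂ _ => hQ n k w₁ w₂⟩
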